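/- **Setting.** Let $X$ be a compact Kähler manifold of dimension $n$, let $D=\sum_k D_k$ be a reduced simple normal crossing divisor on $X$ with irreducible components $D_k$ and canonical section $s_D$ of the line bundle $\mathcal O(D)$ (also written $D$), and put $\psi_D:=\log|s_D|^2-\varphi_D^{\mathrm{sm}}$, where $\varphi_D^{\mathrm{sm}}$ is a smooth potential on $\mathcal O(D)$ chosen such that $\psi_D\le -1$. Let $\sigma_{\mathrm{mlc}}$ be the codimension of the minimal lc centres of $(X,D)$, i.e. the largest $\sigma$ such that $\sigma$ distinct components of $D$ have a common point. A potential $\varphi$ on a holomorphic line bundle (the weight of a possibly singular metric $|\cdot|^2e^{-\varphi}$) is called *admissible* if there are a divisor $P=\sum_k P_k$ such that $D+P$ is reduced with simple normal crossings and constants $b_k>0$ such that locally $\varphi=\sum_k b_k\log|z_k|^2+(\text{smooth})$, where $z_k$ is a local equation of $P_k$. Let $F,M$ be holomorphic line bundles on $X$ with admissible potentials $\varphi_F,\varphi_M$, and let $s\in H^0(X,M)$ be such that $\sup_X|s|^2e^{-\varphi_M}<\infty$. Let $\mathcal I(\varphi)$ be the multiplier ideal sheaf of $\varphi$ and, for $\sigma\ge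 0$, let $\mathcal J_\sigma(\varphi)=\mathcal J_\sigma(\varphi;\psi_D)$ be the adjoint ideal sheaf, whose stalk at $x$ consists of the germs $f\in\mathcal O_{X,x}$ for which there is a neighbourhood $V_x$ of $x$ such that $$\frac{|f|^2e^{-\varphi-\psi_D}}{|\psi_D|^{\sigma}\,(\log|e\psi_D|)^{1+\varepsilon}}\in L^1(V_x)\qquad\text{for all }\varepsilon>0 .$$ Then $\mathcal J_{\sigma}(\varphi)\subseteq\mathcal J_{\sigma'}(\varphi)\subseteq\mathcal I(\varphi)$ for $\sigma\le\sigma'$. Write $\mathcal J_\sigma:=\mathcal J_\sigma(\varphi_F)$ and, for $\sigma\geq 1$, let $\mathcal R_\sigma$ be the residue sheaf, i.e. the quotient $\mathcal J_\sigma/\mathcal J_{\sigma-1}$ in the residue short exact sequence $0\to\mathcal J_{\sigma-1}\to\mathcal J_\sigma\to\mathcal R_\sigma\to0$. Fix $q\ge0$ and put $H(\mathcal G):=H^q(X,K_X\otimes D\otimes F\otimes\mathcal G)$ and $H_M(\mathcal G):=H^q(X,K_X\otimes D\otimes F\otimes M\otimes\mathcal G)$. The inclusions $\mathcal J_\sigma\subseteq\mathcal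 J_{\sigma_{\mathrm{mlc}}}$ induce $$\iota_\sigma:H(\mathcal J_\sigma)\to H(\mathcal J_{\sigma_{\mathrm{mlc}}}),\qquad \tau_\sigma:H(\mathcal R_\sigma)\to H(\mathcal J_{\sigma_{\mathrm{mlc}}}/\mathcal J_{\sigma-1}),$$ and composing with the maps induced by multiplication by $s$ one obtains $$\mu_\sigma:H(\mathcal J_\sigma)\to H_M(\mathcal I(\varphi_F+\varphi_M)),\qquad \nu_\sigma:H(\mathcal R_\sigma)\to H_M\!\left(\frac{\mathcal I(\varphi_F+\varphi_M)}{\mathcal J_{\sigma-1}(\varphi_F+\varphi_M)}\right).$$ **Theorem.** If $\ker\mu_0=\ker\iota_0$ and $\ker\nu_\sigma=\ker\tau_\sigma$ for all $\sigma=1,\dots,\sigma_{\mathrm{mlc}}$, then $\mu_{\sigma_{\mathrm{mlc}}}$ is injective. In particular, let $m\ge1$, $M=F^{\otimes m}$, $\varphi_M=m\varphi_F$ be smooth, and $s\in H^0(X,F^{\otimes m})$. If the above equalities of kernels hold, then the conclusion of Fujino's injectivity conjecture holds in degree $q$: the multiplication map $$H^q(X,K_X\otimes D\otimes F)\xrightarrow{\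 \otimes s\ }H^q(X,K_X\otimes D\otimes F^{\otimes(m+1)})$$ is injective. -/

import Mathlib

open CategoryTheory CategoryTheory.Limits TopologicalSpace Opposite MeasureTheory Topology
open scoped Manifold ContDiff ENNReal NNReal

universe u

noncomputable section

namespace AdjointInjectivity

/-! ### Holomorphic coordinates, line bundles, sections and potentials -/

section Basic

variable {n : ℕ} {X : Type u} [TopologicalSpace X]

/-- `f` is holomorphic near `x`, read in the coordinate chart `c`. -/
def HolAt (c : OpenPartialHomeomorph X (Fin n → ℂ)) (f : X → ℂ) (x : X) : Prop :=
  AnalyticAt ℂ (f ∘ c.symm) (c x)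

/-- The real function `u` is smooth near `x`, read in the coordinate chart `c`. -/
def SmoothAt (c : OpenPartialHomeomorph X (Fin n → ℂ)) (u : X → ℝ) (x : X) : Prop :=
  ContDiffAt ℝ ∞ (u ∘ c.symm) (c x)

/-- Four times the Levi form `∑ ∂²u/∂z_j∂z̄_k v_j v̄_k` of `u` at `z`, evaluated at `v`. -/
def leviForm (u : (Fin n → ℂ) → ℝ) (z v : Fin n → ℂ) : ℝ :=
  iteratedFDeriv ℝ 2 u z ![v, v] + iteratedFDeriv ℝ 2 u z ![Complex.I • v, Complex.I • v]

variable (n X) in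
/-- A holomorphic atlas of the complex manifold `X`: a covering family of holomorphic coordinate
charts.  It is used as the open cover over which line bundles are trivialised. -/
structure HolAtlas [ChartedSpace (Fin n → ℂ) X] where
  ι : Type u
  chart : ι → OpenPartialHomeomorph X (Fin n → ℂ)
  mem_maximalAtlas : ∀ i, chart i ∈ IsManifold.maximalAtlas 𝓘(ℂ, Fin n → ℂ) ω X
  cover : ∀ x, ∃ i, x ∈ (chart i).source

variable [ChartedSpace (Fin n → ℂ) X]

variable (n X) in
/-- `X` carries a Kähler form, given by local potentials: smooth functions `u i` with positive
definite Levi form, whose `i∂∂̄ (u i)` agree on overlaps. -/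
def IsKahler : Prop :=
  ∃ (A : HolAtlas n X) (u : A.ι → X → ℝ),
    (∀ i, ∀ x ∈ (A.chart i).source, SmoothAt (A.chart i) (u i) x ∧
      ∀ v : Fin n → ℂ, v ≠ 0 → 0 < leviForm (u i ∘ (A.chart i).symm) (A.chart i x) v) ∧
    ∀ i j, ∀ x ∈ (A.chart i).source ∩ (A.chart j).source, ∀ v : Fin n → ℂ,
      leviForm ((u i - u j) ∘ (A.chart i).symm) (A.chart i x) v = 0

/-- A holomorphic line bundle trivialised over the charts of `A`, given by its transition
functions: local sections satisfy `s_i = g_{ij} s_j`. -/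
structure LineBundle (A : HolAtlas n X) where
  g : A.ι → A.ι → X → ℂ
  hol : ∀ i j, ∀ x ∈ (A.chart i).source ∩ (A.chart j).source, HolAt (A.chart i) (g i j) x
  self : ∀ i, ∀ x ∈ (A.chart i).source, g i i x = 1
  cocycle : ∀ i j k x, x ∈ (A.chart i).source → x ∈ (A.chart j).source →
    x ∈ (A.chart k).source → g i j x * g j k x = g i k x

variable {A : HolAtlas n X}

/-- The tensor product of two line bundles. -/
def LineBundle.tensor (L M : LineBundle A) : LineBundle A where
  g i j x := L.g i j x * M.g i j x
  hol i j x hx := (L.hol i j x hx).mul (M.hol i j x hx)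
  self i x hx := by simp [L.self i x hx, M.self i x hx]
  cocycle i j k x hi hj hk := by
    rw [← L.cocycle i j k x hi hj hk, ← M.cocycle i j k x hi hj hk]; ring

/-- The tensor power `L^{⊗ m}`. -/
def LineBundle.pow (L : LineBundle A) (m : ℕ) : LineBundle A where
  g i j x := L.g i j x ^ m
  hol i j x hx := (L.hol i j x hx).pow m
  self i x hx := by simp [L.self i x hx]
  cocycle i j k x hi hj hk := by
    rw [← L.cocycle i j k x hi hj hk, mul_pow]

/-- The Jacobian determinant `∂(z^j)/∂(z^i)` of the coordinates `z^j` of the chart `j` with respect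
to the coordinates `z^i` of the chart `i`, at `x`. -/
def jacobian (A : HolAtlas n X) (i j : A.ι) (x : X) : ℂ :=
  Matrix.det (Matrix.of fun a b : Fin n =>
    fderiv ℂ (A.chart j ∘ (A.chart i).symm) (A.chart i x) (Pi.single b 1) a)

lemma analyticAt_transition [IsManifold 𝓘(ℂ, Fin n → ℂ) ω X] (A : HolAtlas n X) (i j : A.ι)
    (x : X) (hi : x ∈ (A.chart i).source) (hj : x ∈ (A.chart j).source) :
    AnalyticAt ℂ (A.chart j ∘ (A.chart i).symm) (A.chart i x) := by
  have h := (contDiffGroupoid ω 𝓘(ℂ, Fin n → ℂ)).compatible_of_mem_maximalAtlas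
    (A.mem_maximalAtlas i) (A.mem_maximalAtlas j)
  rw [contDiffGroupoid, mem_groupoid_of_pregroupoid] at h
  have h1 := h.1
  simp only [contDiffPregroupoid, modelWithCornersSelf_coe,
    modelWithCornersSelf_coe_symm, Function.id_comp, Function.comp_id, Set.preimage_id,
    Set.range_id, Set.inter_univ] at h1
  have hmem : A.chart i x ∈ ((A.chart i).symm.trans (A.chart j)).source := by
    simp [hi, hj]
  have := h1.contDiffAt (((A.chart i).symm.trans (A.chart j)).open_source.mem_nhds hmem)
  rw [← contDiffWithinAt_univ, contDiffWithinAt_omega_iff_analyticWithinAt,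
    analyticWithinAt_univ] at this
  exact this

/-- The canonical bundle `K_X`: a local section `f_i dz^i_1 ∧ … ∧ dz^i_n` transforms by the
Jacobian determinants of the coordinate changes. -/
def canonicalBundle [IsManifold 𝓘(ℂ, Fin n → ℂ) ω X] (A : HolAtlas n X) : LineBundle A where
  g i j x := jacobian A i j x
  hol i j x hx := by
    have hT := analyticAt_transition A i j x hx.1 hx.2
    have h1 : AnalyticAt ℂ (fun z => Matrix.det (Matrix.of fun a b : Fin n =>
        fderiv ℂ (A.chart j ∘ (A.chart i).symm) z (Pi.single b 1) a)) (A.chart i x) := by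
      simp only [Matrix.det_apply, Matrix.of_apply]
      refine Finset.analyticAt_fun_sum _ fun τ _ => ?_
      have hp : AnalyticAt ℂ (fun z => ∏ k : Fin n,
          fderiv ℂ (A.chart j ∘ (A.chart i).symm) z (Pi.single k 1) (τ k)) (A.chart i x) := by
        refine Finset.analyticAt_fun_prod _ fun k _ => ?_
        have h2 := hT.fderiv
        have h3 : AnalyticAt ℂ (fun z => fderiv ℂ (A.chart j ∘ (A.chart i).symm) z
            (Pi.single k 1)) (A.chart i x) := by
          have h5 := ((ContinuousLinearMap.apply ℂ (Fin n → ℂ)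
            (Pi.single k (1 : ℂ) : Fin n → ℂ)).analyticAt _).comp h2
          exact h5
        exact ((ContinuousLinearMap.proj (R := ℂ) (φ := fun _ : Fin n => ℂ) (τ k)).analyticAt _).comp
          h3
      have h4 := (analyticAt_const (v := ((Equiv.Perm.sign τ : ℤ) : ℂ))).mul hp
      refine h4.congr (Filter.Eventually.of_forall fun z => ?_)
      simp [Units.smul_def]
    refine h1.congr ?_
    filter_upwards [(A.chart i).open_target.mem_nhds ((A.chart i).map_source hx.1)] with z hz
    simp [jacobian, (A.chart i).right_inv hz]
  self i x hx := by
    have : fderiv ℂ (A.chart i ∘ (A.chart i).symm) (A.chart i x) =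
        ContinuousLinearMap.id ℂ _ := by
      rw [← fderiv_id (x := A.chart i x)]
      refine Filter.EventuallyEq.fderiv_eq ?_
      filter_upwards [(A.chart i).open_target.mem_nhds ((A.chart i).map_source hx)] with z hz
      simp [(A.chart i).right_inv hz]
    have h2 : (Matrix.of fun a b : Fin n => fderiv ℂ (A.chart i ∘ (A.chart i).symm)
        (A.chart i x) (Pi.single b 1) a) = 1 := by
      ext a b
      simp only [this, Matrix.of_apply, ContinuousLinearMap.id_apply, Matrix.one_apply,
        Pi.single_apply]
    rw [jacobian, h2, Matrix.det_one]
  cocycle i j k x hi hj hk := by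
    have hij := (analyticAt_transition A i j x hi hj).differentiableAt
    have hjk := (analyticAt_transition A j k x hj hk).differentiableAt
    have e : (A.chart j ∘ (A.chart i).symm) (A.chart i x) = A.chart j x := by
      simp [(A.chart i).left_inv hi]
    have hc : fderiv ℂ (A.chart k ∘ (A.chart i).symm) (A.chart i x) =
        (fderiv ℂ (A.chart k ∘ (A.chart j).symm) (A.chart j x)).comp
          (fderiv ℂ (A.chart j ∘ (A.chart i).symm) (A.chart i x)) := by
      rw [← e] at hjk ⊢
      rw [← fderiv_comp _ hjk hij]
      refine Filter.EventuallyEq.fderiv_eq ?_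
      have hcont : ContinuousAt (A.chart i).symm (A.chart i x) :=
        (A.chart i).continuousAt_symm ((A.chart i).map_source hi)
      have hn : (A.chart j).source ∈ 𝓝 ((A.chart i).symm (A.chart i x)) := by
        rw [(A.chart i).left_inv hi]
        exact (A.chart j).open_source.mem_nhds hj
      filter_upwards [hcont hn] with z hz
      simp [(A.chart j).left_inv hz]
    have hm : ∀ T : (Fin n → ℂ) →L[ℂ] (Fin n → ℂ),
        (Matrix.of fun a b : Fin n => T (Pi.single b 1) a) = LinearMap.toMatrix' T.toLinearMap := by
      intro T; ext a b; simp [LinearMap.toMatrix'_apply]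
    have hd : ∀ S T : (Fin n → ℂ) →L[ℂ] (Fin n → ℂ),
        LinearMap.toMatrix' (S.comp T).toLinearMap =
          LinearMap.toMatrix' S.toLinearMap * LinearMap.toMatrix' T.toLinearMap :=
      fun S T => LinearMap.toMatrix'_comp _ _
    simp only [jacobian, hm]
    rw [hc, hd, Matrix.det_mul, mul_comm]

/-- Global holomorphic sections of a line bundle (the values `toFun i x` with `x` outside the
`i`-th chart play no role). -/
structure LineBundle.Section (L : LineBundle A) where
  toFun : A.ι → X → ℂ
  hol : ∀ i, ∀ x ∈ (A.chart i).source, HolAt (A.chart i) (toFun i) x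
  compat : ∀ i j x, x ∈ (A.chart i).source → x ∈ (A.chart j).source →
    toFun i x = L.g i j x * toFun j x

/-- A potential `φ` on `L`, i.e. the datum of a possibly singular metric `|s|² e^{-φ}`: upper
semicontinuous functions `φ_i` with values in `[-∞, ∞)` with `φ_i = φ_j + log |g_{ij}|²`. -/
structure Potential (L : LineBundle A) where
  toFun : A.ι → X → EReal
  ne_top : ∀ i x, toFun i x ≠ ⊤
  usc : ∀ i, UpperSemicontinuousOn (toFun i) (A.chart i).source
  compat : ∀ i j x, x ∈ (A.chart i).source → x ∈ (A.chart j).source →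
    toFun i x = toFun j x + (Real.log (‖L.g i j x‖ ^ 2) : ℝ)

/-- A smooth potential on `L`. -/
structure SmoothPotential (L : LineBundle A) where
  toFun : A.ι → X → ℝ
  smooth : ∀ i, ∀ x ∈ (A.chart i).source, SmoothAt (A.chart i) (toFun i) x
  compat : ∀ i j x, x ∈ (A.chart i).source → x ∈ (A.chart j).source →
    toFun i x = toFun j x + Real.log (‖L.g i j x‖ ^ 2)

/-- The potential `φ` is smooth. -/
def Potential.IsSmooth {L : LineBundle A} (φ : Potential L) : Prop :=
  ∃ v : SmoothPotential L, ∀ i, ∀ x ∈ (A.chart i).source, φ.toFun i x = (v.toFun i x : EReal)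

lemma LineBundle.g_ne_zero (L : LineBundle A) (i j : A.ι) (x : X)
    (hi : x ∈ (A.chart i).source) (hj : x ∈ (A.chart j).source) : L.g i j x ≠ 0 := by
  intro h
  have := L.cocycle i j i x hi hj hi
  rw [h, zero_mul, L.self i x hi] at this
  exact zero_ne_one this

lemma uscOn_add {S : Set X} {f g : X → EReal} (hf : UpperSemicontinuousOn f S)
    (hg : UpperSemicontinuousOn g S) (hf' : ∀ x, f x ≠ ⊤) (hg' : ∀ x, g x ≠ ⊤) :
    UpperSemicontinuousOn (fun x => f x + g x) S :=
  hf.add' hg fun x _ => EReal.continuousAt_add (Or.inl (hf' x)) (Or.inr (hg' x))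

/-- The potential `φ + φ'` on `L ⊗ M`. -/
def Potential.add {L M : LineBundle A} (φ : Potential L) (φ' : Potential M) :
    Potential (L.tensor M) where
  toFun i x := φ.toFun i x + φ'.toFun i x
  ne_top i x := (EReal.add_lt_top (φ.ne_top i x) (φ'.ne_top i x)).ne
  usc i := uscOn_add (φ.usc i) (φ'.usc i) (φ.ne_top i) (φ'.ne_top i)
  compat i j x hi hj := by
    have h1 := L.g_ne_zero i j x hi hj
    have h2 := M.g_ne_zero i j x hi hj
    have e : Real.log (‖(L.tensor M).g i j x‖ ^ 2) =
        Real.log (‖L.g i j x‖ ^ 2) + Real.log (‖M.g i j x‖ ^ 2) := by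
      rw [← Real.log_mul (by positivity) (by positivity), ← mul_pow, ← norm_mul]
      rfl
    rw [e, φ.compat i j x hi hj, φ'.compat i j x hi hj, EReal.coe_add]
    abel

/-- The potential `m φ` on `L^{⊗ m}`. -/
def Potential.smul {L : LineBundle A} (m : ℕ) (φ : Potential L) : Potential (L.pow m) where
  toFun i x := m • φ.toFun i x
  ne_top i x := by
    induction m with
    | zero => simp
    | succ k ih => rw [succ_nsmul]; exact (EReal.add_lt_top ih (φ.ne_top i x)).ne
  usc i := by
    have hne : ∀ (k : ℕ) x, k • φ.toFun i x ≠ ⊤ := by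
      intro k x
      induction k with
      | zero => simp
      | succ k ih => rw [succ_nsmul]; exact (EReal.add_lt_top ih (φ.ne_top i x)).ne
    induction m with
    | zero => simpa using upperSemicontinuousOn_const
    | succ k ih => simpa only [succ_nsmul] using uscOn_add ih (φ.usc i) (hne k) (φ.ne_top i)
  compat i j x hi hj := by
    have e : Real.log (‖(L.pow m).g i j x‖ ^ 2) = m • Real.log (‖L.g i j x‖ ^ 2) := by
      simp only [LineBundle.pow, norm_pow, nsmul_eq_mul]
      rw [← pow_mul, mul_comm m 2, pow_mul, Real.log_pow]
    rw [e, φ.compat i j x hi hj, nsmul_add, EReal.coe_nsmul]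

/-- The condition `sup_X |s|²_φ < ∞` for a section `s` of a line bundle with potential `φ`. -/
def LineBundle.Section.IsBounded {M : LineBundle A} (s : M.Section) (φ : Potential M) : Prop :=
  ∃ C : ℝ≥0, ∀ i, ∀ x ∈ (A.chart i).source,
    ‖s.toFun i x‖ₑ ^ 2 * EReal.exp (-φ.toFun i x) ≤ C

end Basic

/-! ### Simple normal crossing divisors, neat analytic singularities, lc centres -/

section Divisors

variable {n : ℕ} {X : Type u} [TopologicalSpace X] [ChartedSpace (Fin n → ℂ) X]

/-- `z` is a holomorphic coordinate chart around `x` in which the hypersurfaces `E k` passing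
through `x` are distinct coordinate hyperplanes `{z_{c k} = 0}` and which misses the others. -/
structure IsSNCChart {κ : Type} (E : κ → Set X) (x : X)
    (z : OpenPartialHomeomorph X (Fin n → ℂ)) (c : κ → Fin n) : Prop where
  mem_maximalAtlas : z ∈ IsManifold.maximalAtlas 𝓘(ℂ, Fin n → ℂ) ω X
  mem_source : x ∈ z.source
  injOn : Set.InjOn c {k | x ∈ E k}
  inter_eq : ∀ k, x ∈ E k → E k ∩ z.source = {y ∈ z.source | z y (c k) = 0}
  inter_empty : ∀ k, x ∉ E k → E k ∩ z.source = ∅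

variable (n) in
/-- The `E k` are the irreducible (i.e. connected, being smooth) components of a reduced divisor
with simple normal crossings. -/
structure IsSNC {κ : Type} (E : κ → Set X) : Prop where
  isClosed : ∀ k, IsClosed (E k)
  isConnected : ∀ k, IsConnected (E k)
  exists_chart : ∀ x, ∃ (z : OpenPartialHomeomorph X (Fin n → ℂ)) (c : κ → Fin n),
    IsSNCChart E x z c

open Classical in
/-- A reduced simple normal crossing divisor `D = ∑ D_k`, given by its irreducible components
together with the line bundle `𝒪(D)` and its canonical section `s_D`, which vanishes exactly to
order one along each `D_k` and nowhere else. -/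
structure SNCDivisor (A : HolAtlas n X) where
  r : ℕ
  comp : Fin r → Set X
  isSNC : IsSNC n comp
  bundle : LineBundle A
  sec : bundle.Section
  sec_eq : ∀ i, ∀ x ∈ (A.chart i).source,
    ∃ (z : OpenPartialHomeomorph X (Fin n → ℂ)) (c : Fin r → Fin n) (v : X → ℂ),
      IsSNCChart comp x z c ∧ HolAt (A.chart i) v x ∧ v x ≠ 0 ∧
      ∀ᶠ y in 𝓝 x, sec.toFun i y = v y * ∏ k : Fin r with x ∈ comp k, z y (c k)

variable {A : HolAtlas n X}

/-- The union `lc^σ_X(D)` of the `σ`-lc centres of `(X, D)`, i.e. of the intersections of `σ`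
distinct components of `D`. -/
def SNCDivisor.lcc (D : SNCDivisor A) (σ : ℕ) : Set X :=
  {x | ∃ S : Finset (Fin D.r), S.card = σ ∧ ∀ k ∈ S, x ∈ D.comp k}

/-- The codimension `σ_mlc` of the minimal lc centres of `(X, D)`. -/
def SNCDivisor.mlc (D : SNCDivisor A) : ℕ := sSup {σ | (D.lcc σ).Nonempty}

open Classical in
/-- `φ` has neat analytic singularities along a divisor `P = ∑ P_k` such that `D + P` is a reduced
divisor with simple normal crossings (so `P` has no component in common with `D`): locally `φ` is
`∑ b_k log |z_k|²` up to a smooth function, where `z_k` is a local equation of `P_k` and `b_k > 0`.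
Such a `φ` is quasi-plurisubharmonic and its polar set `φ⁻¹(-∞)` is `⋃ P_k`. -/
def Potential.IsNeat {L : LineBundle A} (φ : Potential L) (D : SNCDivisor A) : Prop :=
  ∃ (t : ℕ) (P : Fin t → Set X) (b : Fin t → ℝ), (∀ k, 0 < b k) ∧
    IsSNC n (Sum.elim D.comp P) ∧
    ∀ i, ∀ x ∈ (A.chart i).source,
      ∃ (z : OpenPartialHomeomorph X (Fin n → ℂ)) (c : Fin D.r ⊕ Fin t → Fin n) (v : X → ℝ),
        IsSNCChart (Sum.elim D.comp P) x z c ∧ (∀ᶠ y in 𝓝 x, SmoothAt (A.chart i) v y) ∧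
        ∀ᶠ y in 𝓝 x, φ.toFun i y =
          (∑ k : Fin t with x ∈ P k,
            (b k : EReal) * ENNReal.log (‖z y (c (Sum.inr k))‖ₑ ^ 2)) + (v y : EReal)

/-- A log smooth lc pair `(X, D)` with a smooth potential `φ^sm_D` on `𝒪(D)` such that
`ψ_D := log |s_D|² - φ^sm_D ≤ -1`. -/
structure LogPair (A : HolAtlas n X) where
  D : SNCDivisor A
  sm : SmoothPotential D.bundle
  le_neg_one : ∀ i, ∀ x ∈ (A.chart i).source, D.sec.toFun i x ≠ 0 →
    Real.log (‖D.sec.toFun i x‖ ^ 2) - sm.toFun i x ≤ -1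

/-- The global function `ψ_D = log |s_D|² - φ^sm_D` on `X \ D`, computed in the `i`-th chart. -/
def LogPair.psi (P : LogPair A) (i : A.ι) (x : X) : ℝ :=
  Real.log (‖P.D.sec.toFun i x‖ ^ 2) - P.sm.toFun i x

/-- The function `e^{-ψ_D} / (|ψ_D|^σ (log |e ψ_D|)^{1+ε})`, with its limit value `+∞` on `D`. -/
def LogPair.poleWeight (P : LogPair A) (σ : ℕ) (ε : ℝ) (i : A.ι) (x : X) : ℝ≥0∞ :=
  if P.D.sec.toFun i x = 0 then ⊤ else
    ENNReal.ofReal (Real.exp (-P.psi i x) /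
      (|P.psi i x| ^ σ * Real.log (Real.exp 1 * |P.psi i x|) ^ (1 + ε)))

end Divisors

/-! ### Multiplier ideal sheaves and adjoint ideal sheaves -/

section Ideals

variable {n : ℕ} {X : Type u} [TopologicalSpace X]

lemma measurableSet_image (c : OpenPartialHomeomorph X (Fin n → ℂ)) {V : Set X} (hV : IsOpen V)
    (hVc : V ⊆ c.source) : MeasurableSet (c '' V) :=
  (c.isOpen_image_of_subset_source hV hVc).measurableSet

lemma lintegral_mono_nhds (c : OpenPartialHomeomorph X (Fin n → ℂ)) {V V' : Set X} (h : V ⊆ V')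
    (F : (Fin n → ℂ) → ℝ≥0∞) (hF : ∫⁻ z in c '' V', F z < ⊤) : ∫⁻ z in c '' V, F z < ⊤ :=
  (lintegral_mono_set (Set.image_mono h)).trans_lt hF

/-- A germ at `x` of a holomorphic function is holomorphic, hence continuous, near `x`. -/
lemma HolAt.exists_nhds {c : OpenPartialHomeomorph X (Fin n → ℂ)} {h : X → ℂ} {x : X}
    (hx : x ∈ c.source) (hh : HolAt c h x) : ∃ V : Set X, IsOpen V ∧ x ∈ V ∧ V ⊆ c.source ∧
      ContinuousOn (h ∘ c.symm) (c '' V) := by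
  obtain ⟨N, hN, hNo, hxN⟩ := eventually_nhds_iff.1 hh.eventually_analyticAt
  refine ⟨c.source ∩ c ⁻¹' N, c.isOpen_inter_preimage hNo, ⟨hx, hxN⟩, Set.inter_subset_left, ?_⟩
  rintro _ ⟨y, hy, rfl⟩
  exact (hN _ hy.2).continuousAt.continuousWithinAt

/-- Functions representing germs at `x` of holomorphic functions `h` such that for some open
neighbourhood `V` of `x` all the integrals `∫_V |h|² w` with `w ∈ W` are finite (with respect to
the Lebesgue measure in the coordinates of the chart `c`). -/
def l2Germs (c : OpenPartialHomeomorph X (Fin n → ℂ)) (W : Set (X → ℝ≥0∞))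
    (hW : ∀ w ∈ W, Measurable fun z : c.target => w (c.symm z)) (x : X) :
    AddSubgroup (X → ℂ) where
  carrier := {h | HolAt c h x ∧ (x ∈ c.source → ∃ V : Set X, IsOpen V ∧ x ∈ V ∧ V ⊆ c.source ∧
    ∀ w ∈ W, ∫⁻ z in c '' V, ‖h (c.symm z)‖ₑ ^ 2 * w (c.symm z) < ⊤)}
  zero_mem' := ⟨analyticAt_const, fun hx => ⟨c.source, c.open_source, hx, subset_rfl, by simp⟩⟩
  add_mem' := by
    rintro a b ⟨ha, ha'⟩ ⟨hb, hb'⟩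
    refine ⟨AnalyticAt.add ha hb, fun hx => ?_⟩
    obtain ⟨V₁, o₁, m₁, s₁, i₁⟩ := ha' hx
    obtain ⟨V₂, o₂, m₂, s₂, i₂⟩ := hb' hx
    obtain ⟨V₃, o₃, m₃, s₃, i₃⟩ := HolAt.exists_nhds hx ha
    refine ⟨V₁ ∩ V₂ ∩ V₃, (o₁.inter o₂).inter o₃, ⟨⟨m₁, m₂⟩, m₃⟩, fun y hy => s₃ hy.2, ?_⟩
    intro w hw
    set S := c '' (V₁ ∩ V₂ ∩ V₃) with hS
    have hSm : MeasurableSet S :=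
      measurableSet_image c ((o₁.inter o₂).inter o₃) fun y hy => s₃ hy.2
    have hSt : S ⊆ c.target := by
      rintro _ ⟨y, hy, rfl⟩
      exact c.map_source (s₃ hy.2)
    have hwm : AEMeasurable (fun z => w (c.symm z)) (volume.restrict S) := by
      refine aemeasurable_restrict_of_measurable_subtype hSm ?_
      exact (hW w hw).comp (measurable_inclusion hSt)
    have ham : AEMeasurable (fun z => ‖a (c.symm z)‖ₑ ^ 2) (volume.restrict S) := by
      have : AEMeasurable (a ∘ c.symm) (volume.restrict S) :=
        (i₃.mono (Set.image_mono Set.inter_subset_right)).aemeasurable hSm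
      exact (this.enorm).pow_const 2
    have key : ∀ z, ‖(a + b) (c.symm z)‖ₑ ^ 2 * w (c.symm z) ≤
        2 * (‖a (c.symm z)‖ₑ ^ 2 * w (c.symm z)) + 2 * (‖b (c.symm z)‖ₑ ^ 2 * w (c.symm z)) := by
      intro z
      have h1 : ‖(a + b) (c.symm z)‖ₑ ^ 2 ≤
          2 * ‖a (c.symm z)‖ₑ ^ 2 + 2 * ‖b (c.symm z)‖ₑ ^ 2 := by
        have h2 : ‖(a + b) (c.symm z)‖ ^ 2 ≤
            2 * ‖a (c.symm z)‖ ^ 2 + 2 * ‖b (c.symm z)‖ ^ 2 := by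
          have := norm_add_le (a (c.symm z)) (b (c.symm z))
          have h0 := norm_nonneg (a (c.symm z) + b (c.symm z))
          simp only [Pi.add_apply]
          nlinarith [sq_nonneg (‖a (c.symm z)‖ - ‖b (c.symm z)‖)]
        have e : ∀ v : ℂ, ‖v‖ₑ ^ 2 = ENNReal.ofReal (‖v‖ ^ 2) := fun v => by
          rw [ENNReal.ofReal_pow (norm_nonneg _), ofReal_norm]
        have e2 : (2 : ℝ≥0∞) = ENNReal.ofReal 2 := by simp
        rw [e, e, e, e2, ← ENNReal.ofReal_mul (by norm_num), ← ENNReal.ofReal_mul (by norm_num),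
          ← ENNReal.ofReal_add (by positivity) (by positivity)]
        exact ENNReal.ofReal_le_ofReal h2
      calc _ ≤ _ := mul_le_mul_left h1 _
        _ = _ := by ring
    have I1 : ∫⁻ z in S, ‖a (c.symm z)‖ₑ ^ 2 * w (c.symm z) < ⊤ :=
      lintegral_mono_nhds c (fun y hy => hy.1.1) _ (i₁ w hw)
    have I2 : ∫⁻ z in S, ‖b (c.symm z)‖ₑ ^ 2 * w (c.symm z) < ⊤ :=
      lintegral_mono_nhds c (fun y hy => hy.1.2) _ (i₂ w hw)
    refine (lintegral_mono key).trans_lt ?_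
    have hm2 : AEMeasurable (fun z => 2 * (‖a (c.symm z)‖ₑ ^ 2 * w (c.symm z)))
        (volume.restrict S) := (ham.mul hwm).const_mul 2
    rw [lintegral_add_left' hm2, lintegral_const_mul' _ _ (by simp),
      lintegral_const_mul' _ _ (by simp)]
    exact ENNReal.add_lt_top.2 ⟨ENNReal.mul_lt_top (by simp) I1, ENNReal.mul_lt_top (by simp) I2⟩
  neg_mem' := by
    rintro a ⟨ha, ha'⟩
    refine ⟨AnalyticAt.neg ha, fun hx => ?_⟩
    obtain ⟨V, o, m, s, i⟩ := ha' hx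
    exact ⟨V, o, m, s, fun w hw => by simpa using i w hw⟩

lemma continuous_comp_symm {c : OpenPartialHomeomorph X (Fin n → ℂ)} {Y : Type*}
    [TopologicalSpace Y] {f : X → Y}
    (hf : ∀ x ∈ c.source, ContinuousAt (f ∘ c.symm) (c x)) :
    Continuous fun z : c.target => f (c.symm z) := by
  rw [continuous_iff_continuousAt]
  rintro ⟨z, hz⟩
  have h := hf (c.symm z) (c.map_target hz)
  rw [c.right_inv hz] at h
  exact ContinuousAt.comp (g := f ∘ c.symm) (f := (Subtype.val : c.target → Fin n → ℂ)) h
    continuousAt_subtype_val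

lemma continuousAt_of_comp_symm (c : OpenPartialHomeomorph X (Fin n → ℂ)) {Y : Type*}
    [TopologicalSpace Y] {f : X → Y} {x : X} (hx : x ∈ c.source)
    (hf : ContinuousAt (f ∘ c.symm) (c x)) : ContinuousAt f x :=
  (c.symm.continuousAt_iff_continuousAt_comp_right (by simpa using hx)).2 (by simpa using hf)

lemma exp_neg_add {a b : EReal} (ha : a ≠ ⊤) (hb : b ≠ ⊤) :
    EReal.exp (-(a + b)) = EReal.exp (-a) * EReal.exp (-b) := by
  rw [EReal.exp_neg, EReal.exp_neg, EReal.exp_neg, EReal.exp_add, ENNReal.mul_inv]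
  · exact Or.inr (by simpa using hb)
  · exact Or.inl (by simpa using ha)

/-- Comparison of the `L²` conditions: multiplication by a holomorphic function `s` maps one into
the other as soon as each weight `w'` satisfies `|s|² w' ≤ C w` for some `w`. -/
lemma mul_mem_l2Germs {c : OpenPartialHomeomorph X (Fin n → ℂ)} {W W' : Set (X → ℝ≥0∞)} {hW hW'}
    {x : X} {s h : X → ℂ} (hs : HolAt c s x)
    (hle : ∀ w' ∈ W', ∃ w ∈ W, ∃ C : ℝ≥0, ∀ y ∈ c.source, ‖s y‖ₑ ^ 2 * w' y ≤ C * w y)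
    (hh : h ∈ l2Germs c W hW x) : s * h ∈ l2Germs c W' hW' x := by
  refine ⟨AnalyticAt.mul hs hh.1, fun hx => ?_⟩
  obtain ⟨V, o, m, sV, iV⟩ := hh.2 hx
  refine ⟨V, o, m, sV, fun w' hw' => ?_⟩
  obtain ⟨w, hw, C, hC⟩ := hle w' hw'
  refine (setLIntegral_mono' (g := fun z => C * (‖h (c.symm z)‖ₑ ^ 2 * w (c.symm z)))
    (measurableSet_image c o sV) ?_).trans_lt ?_
  · rintro _ ⟨y, hy, rfl⟩
    rw [c.left_inv (sV hy), Pi.mul_apply, enorm_mul, mul_pow]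
    calc ‖s y‖ₑ ^ 2 * ‖h y‖ₑ ^ 2 * w' y = ‖h y‖ₑ ^ 2 * (‖s y‖ₑ ^ 2 * w' y) := by ring
      _ ≤ ‖h y‖ₑ ^ 2 * (C * w y) := mul_le_mul_right (hC y (sV hy)) _
      _ = C * (‖h y‖ₑ ^ 2 * w y) := by ring
  · rw [lintegral_const_mul' _ _ (by simp)]
    exact ENNReal.mul_lt_top (by simp) (iV w hw)

lemma l2Germs_mono {c : OpenPartialHomeomorph X (Fin n → ℂ)} {W W' : Set (X → ℝ≥0∞)} {hW hW'}
    {x : X} (hle : ∀ w' ∈ W', ∃ w ∈ W, ∃ C : ℝ≥0, ∀ y ∈ c.source, w' y ≤ C * w y) :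
    l2Germs c W hW x ≤ l2Germs c W' hW' x := by
  intro h hh
  have := mul_mem_l2Germs (hW' := hW') (s := 1) (analyticAt_const) (by simpa using hle) hh
  simpa using this

variable [ChartedSpace (Fin n → ℂ) X] {A : HolAtlas n X}

lemma Potential.measurable {L : LineBundle A} (φ : Potential L) (i : A.ι) :
    Measurable fun z : (A.chart i).target => EReal.exp (-φ.toFun i ((A.chart i).symm z)) := by
  have h : UpperSemicontinuous fun z : (A.chart i).target => φ.toFun i ((A.chart i).symm z) := by
    rintro ⟨z, hz⟩
    have h1 := φ.usc i _ ((A.chart i).map_target hz)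
    intro y hy
    have h2 := h1 y hy
    have h3 : Filter.Tendsto (fun w : (A.chart i).target => (A.chart i).symm w) (𝓝 ⟨z, hz⟩)
        (𝓝[(A.chart i).source] ((A.chart i).symm z)) := by
      refine tendsto_nhdsWithin_iff.2 ⟨?_, Filter.Eventually.of_forall fun w =>
        (A.chart i).map_target w.2⟩
      exact ContinuousAt.comp (g := (A.chart i).symm)
        (f := (Subtype.val : (A.chart i).target → Fin n → ℂ))
        ((A.chart i).continuousAt_symm hz) continuousAt_subtype_val
    exact h3.eventually h2
  have h' := h.measurable
  exact EReal.exp_monotone.measurable.comp (continuous_neg.measurable.comp h')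

lemma LogPair.measurable_poleWeight (P : LogPair A) (σ : ℕ) (ε : ℝ) (i : A.ι) :
    Measurable fun z : (A.chart i).target => P.poleWeight σ ε i ((A.chart i).symm z) := by
  have hs : Continuous fun z : (A.chart i).target => P.D.sec.toFun i ((A.chart i).symm z) :=
    continuous_comp_symm fun x hx => (P.D.sec.hol i x hx).continuousAt
  have hv : Continuous fun z : (A.chart i).target => P.sm.toFun i ((A.chart i).symm z) :=
    continuous_comp_symm fun x hx => (P.sm.smooth i x hx).continuousAt
  have hp : Measurable fun z : (A.chart i).target => P.psi i ((A.chart i).symm z) :=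
    (Real.measurable_log.comp (hs.norm.pow 2).measurable).sub hv.measurable
  have ha : Measurable fun z : (A.chart i).target => |P.psi i ((A.chart i).symm z)| :=
    continuous_abs.measurable.comp hp
  refine Measurable.ite (hs.measurable (measurableSet_singleton 0)) measurable_const ?_
  refine ENNReal.measurable_ofReal.comp ?_
  exact (Real.measurable_exp.comp hp.neg).div ((ha.pow_const σ).mul
    ((Real.measurable_log.comp (ha.const_mul _)).pow_const _))

/-- An assignment of a group of (representatives of) germs of functions to every point, in the
coordinates and trivialisations of every chart. -/
abbrev GermFamily (A : HolAtlas n X) := A.ι → X → AddSubgroup (X → ℂ)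

variable (A) in
/-- The structure sheaf `𝒪_X`. -/
def structureGerms : GermFamily A := fun i x =>
  { carrier := {h | HolAt (A.chart i) h x}
    zero_mem' := analyticAt_const
    add_mem' := fun ha hb => AnalyticAt.add ha hb
    neg_mem' := fun ha => AnalyticAt.neg ha }

/-- The multiplier ideal sheaf `ℐ(φ)`: germs `h` with `|h|² e^{-φ}` locally integrable. -/
def Potential.multiplierIdeal {L : LineBundle A} (φ : Potential L) : GermFamily A := fun i =>
  l2Germs (A.chart i) {fun y => EReal.exp (-φ.toFun i y)} (by
    rintro w rfl
    exact φ.measurable i)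

/-- The adjoint ideal sheaf `𝒥_σ(φ; ψ_D)`: germs `h` such that, on some neighbourhood of the point,
`|h|² e^{-φ-ψ_D} / (|ψ_D|^σ (log |e ψ_D|)^{1+ε})` is integrable for all `ε > 0`. -/
def LogPair.adjointIdeal (P : LogPair A) {L : LineBundle A} (σ : ℕ) (φ : Potential L) :
    GermFamily A := fun i =>
  l2Germs (A.chart i)
    {w | ∃ ε : ℝ, 0 < ε ∧ w = fun y => EReal.exp (-φ.toFun i y) * P.poleWeight σ ε i y} (by
    rintro w ⟨ε, -, rfl⟩
    exact (φ.measurable i).mul (P.measurable_poleWeight σ ε i))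

variable (P : LogPair A)

lemma LogPair.one_le_abs_psi (i : A.ι) (y : X) (hy : y ∈ (A.chart i).source)
    (h0 : P.D.sec.toFun i y ≠ 0) : 1 ≤ |P.psi i y| ∧ P.psi i y = -|P.psi i y| := by
  have h : P.psi i y ≤ -1 := P.le_neg_one i y hy h0
  have := abs_of_nonpos (a := P.psi i y) (by linarith)
  constructor <;> linarith

lemma one_le_log_exp {t : ℝ} (ht : 1 ≤ t) : 1 ≤ Real.log (Real.exp 1 * t) := by
  rw [Real.log_mul (Real.exp_ne_zero 1) (by linarith), Real.log_exp]
  linarith [Real.log_nonneg ht]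

/-- The inclusions `𝒥_σ ⊆ 𝒥_σ'` for `σ ≤ σ'`. -/
lemma LogPair.adjointIdeal_mono {L : LineBundle A} (φ : Potential L) {σ σ' : ℕ} (hσ : σ ≤ σ')
    (i : A.ι) (x : X) : P.adjointIdeal σ φ i x ≤ P.adjointIdeal σ' φ i x := by
  refine l2Germs_mono ?_
  rintro _ ⟨ε, hε, rfl⟩
  refine ⟨_, ⟨ε, hε, rfl⟩, 1, fun y hy => ?_⟩
  rw [ENNReal.coe_one, one_mul]
  refine mul_le_mul_right ?_ _
  unfold LogPair.poleWeight
  split_ifs with h0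
  · exact le_rfl
  · refine ENNReal.ofReal_le_ofReal ?_
    obtain ⟨h1, -⟩ := P.one_le_abs_psi i y hy h0
    have h2 := one_le_log_exp h1
    have h3 : 0 < |P.psi i y| ^ σ := by positivity
    gcongr

/-- The inclusion `𝒥_σ(φ; ψ_D) ⊆ ℐ(φ)`. -/
lemma LogPair.adjointIdeal_le {L : LineBundle A} (φ : Potential L) (σ : ℕ)
    (i : A.ι) (x : X) : P.adjointIdeal σ φ i x ≤ φ.multiplierIdeal i x := by
  refine l2Germs_mono ?_
  rintro _ rfl
  refine ⟨_, ⟨1, one_pos, rfl⟩, ((σ + 2).factorial : ℝ≥0), fun y hy => ?_⟩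
  have key : 1 ≤ (((σ + 2).factorial : ℝ≥0) : ℝ≥0∞) * P.poleWeight σ 1 i y := by
    unfold LogPair.poleWeight
    split_ifs with h0
    · rw [ENNReal.mul_top (by simp [Nat.factorial_ne_zero])]
      exact le_top
    · obtain ⟨h1, h2⟩ := P.one_le_abs_psi i y hy h0
      set t := |P.psi i y| with ht
      have h3 := one_le_log_exp h1
      have h4 : Real.log (Real.exp 1 * t) ≤ t := by
        rw [Real.log_mul (Real.exp_ne_zero 1) (by linarith), Real.log_exp]
        linarith [Real.log_le_sub_one_of_pos (show 0 < t by linarith)]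
      have h5 := Real.pow_div_factorial_le_exp t (by linarith) (σ + 2)
      rw [h2, neg_neg]
      have e : ((((σ + 2).factorial : ℝ≥0)) : ℝ≥0∞) = ENNReal.ofReal ((σ + 2).factorial : ℝ) := by
        simp
      rw [e, ← ENNReal.ofReal_mul (by positivity), ENNReal.one_le_ofReal]
      have h6 : (0 : ℝ) < t ^ σ * Real.log (Real.exp 1 * t) ^ ((1 : ℝ) + 1) := by positivity
      rw [← mul_div_assoc, one_le_div h6]
      have h7 : Real.log (Real.exp 1 * t) ^ ((1 : ℝ) + 1) ≤ t ^ 2 := by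
        have : ((1 : ℝ) + 1) = ((2 : ℕ) : ℝ) := by norm_num
        rw [this, Real.rpow_natCast]
        gcongr
      rw [div_le_iff₀ (by positivity)] at h5
      calc _ ≤ t ^ σ * t ^ 2 := by gcongr
        _ = t ^ (σ + 2) := by ring
        _ ≤ _ := by linarith
  calc EReal.exp (-φ.toFun i y) = EReal.exp (-φ.toFun i y) * 1 := (mul_one _).symm
    _ ≤ EReal.exp (-φ.toFun i y) *
        ((((σ + 2).factorial : ℝ≥0) : ℝ≥0∞) * P.poleWeight σ 1 i y) := mul_le_mul_right key _
    _ = _ := by ring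

/-- Multiplication by a bounded section `s` maps `ℐ(φ)` to `ℐ(φ + φ')`. -/
lemma Potential.mul_mem_multiplierIdeal {L M : LineBundle A} (φ : Potential L) (φ' : Potential M)
    (s : M.Section) (hs : s.IsBounded φ') (i : A.ι) (x : X) (hx : x ∈ (A.chart i).source)
    (h : X → ℂ) (hh : h ∈ φ.multiplierIdeal i x) :
    s.toFun i * h ∈ (φ.add φ').multiplierIdeal i x := by
  obtain ⟨C, hC⟩ := hs
  refine mul_mem_l2Germs (s.hol i x hx) ?_ hh
  rintro _ rfl
  refine ⟨_, rfl, C, fun y hy => ?_⟩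
  have e : EReal.exp (-(φ.add φ').toFun i y) =
      EReal.exp (-φ.toFun i y) * EReal.exp (-φ'.toFun i y) :=
    exp_neg_add (φ.ne_top i y) (φ'.ne_top i y)
  simp only [e]
  calc _ = (‖s.toFun i y‖ₑ ^ 2 * EReal.exp (-φ'.toFun i y)) * EReal.exp (-φ.toFun i y) := by ring
    _ ≤ _ := mul_le_mul_left (hC i y hy) _

/-- Multiplication by a bounded section `s` maps `𝒥_σ(φ; ψ_D)` to `𝒥_σ(φ + φ'; ψ_D)`. -/
lemma LogPair.mul_mem_adjointIdeal {L M : LineBundle A} (φ : Potential L) (φ' : Potential M)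
    (s : M.Section) (hs : s.IsBounded φ') (σ : ℕ) (i : A.ι) (x : X)
    (hx : x ∈ (A.chart i).source) (h : X → ℂ) (hh : h ∈ P.adjointIdeal σ φ i x) :
    s.toFun i * h ∈ P.adjointIdeal σ (φ.add φ') i x := by
  obtain ⟨C, hC⟩ := hs
  refine mul_mem_l2Germs (s.hol i x hx) ?_ hh
  rintro _ ⟨ε, hε, rfl⟩
  refine ⟨_, ⟨ε, hε, rfl⟩, C, fun y hy => ?_⟩
  have e : EReal.exp (-(φ.add φ').toFun i y) =
      EReal.exp (-φ.toFun i y) * EReal.exp (-φ'.toFun i y) :=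
    exp_neg_add (φ.ne_top i y) (φ'.ne_top i y)
  simp only [e]
  calc _ = (‖s.toFun i y‖ₑ ^ 2 * EReal.exp (-φ'.toFun i y)) *
        (EReal.exp (-φ.toFun i y) * P.poleWeight σ ε i y) := by ring
    _ ≤ _ := mul_le_mul_left (hC i y hy) _

lemma norm_sq_mul_exp_eq {M : LineBundle A} (s : M.Section) (v : SmoothPotential M) (i j : A.ι)
    (x : X) (hi : x ∈ (A.chart i).source) (hj : x ∈ (A.chart j).source) :
    ‖s.toFun i x‖ ^ 2 * Real.exp (-v.toFun i x) = ‖s.toFun j x‖ ^ 2 * Real.exp (-v.toFun j x) := by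
  have hg := M.g_ne_zero i j x hi hj
  rw [s.compat i j x hi hj, v.compat i j x hi hj, neg_add, Real.exp_add, Real.exp_neg (Real.log _),
    Real.exp_log (by positivity), norm_mul, mul_pow]
  field_simp

/-- On a compact manifold every section is bounded with respect to a smooth potential. -/
lemma LineBundle.Section.isBounded [CompactSpace X] {M : LineBundle A} (s : M.Section)
    {φ : Potential M} (hφ : φ.IsSmooth) : s.IsBounded φ := by
  obtain ⟨v, hv⟩ := hφ
  have hloc : ∀ x : X, ∃ U ∈ 𝓝 x, ∃ C : ℝ, ∀ y ∈ U, ∀ j, y ∈ (A.chart j).source →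
      ‖s.toFun j y‖ ^ 2 * Real.exp (-v.toFun j y) ≤ C := by
    intro x
    obtain ⟨i, hi⟩ := A.cover x
    have hc : ContinuousAt (fun y => ‖s.toFun i y‖ ^ 2 * Real.exp (-v.toFun i y)) x := by
      have h1 := continuousAt_of_comp_symm _ hi (s.hol i x hi).continuousAt
      have h2 := continuousAt_of_comp_symm _ hi (v.smooth i x hi).continuousAt
      exact (h1.norm.pow 2).mul (Real.continuous_exp.continuousAt.comp h2.neg)
    refine ⟨{y | y ∈ (A.chart i).source ∧ ‖s.toFun i y‖ ^ 2 * Real.exp (-v.toFun i y) <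
      ‖s.toFun i x‖ ^ 2 * Real.exp (-v.toFun i x) + 1}, ?_,
      ‖s.toFun i x‖ ^ 2 * Real.exp (-v.toFun i x) + 1, ?_⟩
    · exact Filter.inter_mem ((A.chart i).open_source.mem_nhds hi)
        (hc.eventually_lt continuousAt_const (by simp))
    · rintro y ⟨hy, hy'⟩ j hj
      rw [norm_sq_mul_exp_eq s v j i y hj hy]
      exact hy'.le
  choose U hU C hC using hloc
  obtain ⟨T, -, hT⟩ := isCompact_univ.elim_nhds_subcover U fun x _ => hU x
  refine ⟨∑ x ∈ T, (C x).toNNReal, fun j y hj => ?_⟩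
  have hyT : y ∈ ⋃ x ∈ T, U x := hT (Set.mem_univ y)
  simp only [Set.mem_iUnion] at hyT
  obtain ⟨x, hxT, hyx⟩ := hyT
  have h1 := hC x y hyx j hj
  rw [hv j y hj, ← EReal.coe_neg, EReal.exp_coe]
  have e : ‖s.toFun j y‖ₑ ^ 2 = ENNReal.ofReal (‖s.toFun j y‖ ^ 2) := by
    rw [ENNReal.ofReal_pow (norm_nonneg _), ofReal_norm]
  rw [e, ← ENNReal.ofReal_mul (by positivity)]
  refine (ENNReal.ofReal_le_ofReal h1).trans ?_
  rw [ENNReal.ofReal]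
  exact_mod_cast Finset.single_le_sum (f := fun x => (C x).toNNReal) (fun _ _ => zero_le) hxT

end Ideals

/-! ### The sheaves `L ⊗ 𝒥`, the morphisms between them, and their cohomology -/

section Sheaves

variable {n : ℕ} {X : Type u} [TopologicalSpace X] [ChartedSpace (Fin n → ℂ) X]
  {A : HolAtlas n X}

/-- Sections of `L ⊗ 𝒥` over `U`: families of functions `f_i` on the `U ∩ V_i` (`V_i` the domain of
the `i`-th chart, `f_i` extended by zero) with `f_i = g_{ij} f_j`, whose germs lie in `𝒥`. -/
def LineBundle.sections (L : LineBundle A) (J : GermFamily A) (U : Opens X) :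
    AddSubgroup (U → A.ι → ℂ) where
  carrier := {f | (∀ (x : U) (i : A.ι), x.1 ∉ (A.chart i).source → f x i = 0) ∧
    (∀ (x : U) (i j : A.ι), x.1 ∈ (A.chart i).source → x.1 ∈ (A.chart j).source →
      f x i = L.g i j x * f x j) ∧
    ∀ (x : U) (i : A.ι), x.1 ∈ (A.chart i).source → ∃ h ∈ J i x.1,
      ∀ᶠ y in 𝓝 x.1, ∀ hy : y ∈ U, f ⟨y, hy⟩ i = h y}
  zero_mem' := ⟨fun _ _ _ => rfl, fun _ _ _ _ _ => by simp, fun x i _ =>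
    ⟨0, zero_mem _, Filter.Eventually.of_forall fun _ _ => rfl⟩⟩
  add_mem' := by
    rintro a b ⟨a1, a2, a3⟩ ⟨b1, b2, b3⟩
    refine ⟨fun x i hx => by simp [a1 x i hx, b1 x i hx], fun x i j hi hj => ?_, fun x i hx => ?_⟩
    · simp only [Pi.add_apply]
      rw [a2 x i j hi hj, b2 x i j hi hj]; ring
    · obtain ⟨h, hh, eh⟩ := a3 x i hx
      obtain ⟨k, hk, ek⟩ := b3 x i hx
      refine ⟨h + k, add_mem hh hk, ?_⟩
      filter_upwards [eh, ek] with y h1 h2 hy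
      simp [h1 hy, h2 hy]
  neg_mem' := by
    rintro a ⟨a1, a2, a3⟩
    refine ⟨fun x i hx => by simp [a1 x i hx], fun x i j hi hj => ?_, fun x i hx => ?_⟩
    · simp only [Pi.neg_apply]
      rw [a2 x i j hi hj]; ring
    · obtain ⟨h, hh, eh⟩ := a3 x i hx
      refine ⟨-h, neg_mem hh, ?_⟩
      filter_upwards [eh] with y h1 hy
      simp [h1 hy]

/-- The local predicate defining the sections of `L ⊗ 𝒥`. -/
def LineBundle.localPredicate (L : LineBundle A) (J : GermFamily A) :
    TopCat.LocalPredicate (X := TopCat.of X) fun _ => A.ι → ℂ where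
  pred {U} f := f ∈ L.sections J U
  res {U V} k f hf := by
    obtain ⟨f1, f2, f3⟩ := hf
    refine ⟨fun x i hx => f1 ⟨x.1, k.le x.2⟩ i hx,
      fun x i j hi hj => f2 ⟨x.1, k.le x.2⟩ i j hi hj, fun x i hx => ?_⟩
    obtain ⟨h, hh, eh⟩ := f3 ⟨x.1, k.le x.2⟩ i hx
    refine ⟨h, hh, ?_⟩
    filter_upwards [eh] with y h1 hy
    exact h1 (k.le hy)
  locality {U} f w := by
    refine ⟨fun x i hx => ?_, fun x i j hi hj => ?_, fun x i hx => ?_⟩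
    · obtain ⟨V, m, k, f1, -, -⟩ := w x
      exact f1 ⟨x.1, m⟩ i hx
    · obtain ⟨V, m, k, -, f2, -⟩ := w x
      exact f2 ⟨x.1, m⟩ i j hi hj
    · obtain ⟨V, m, k, -, -, f3⟩ := w x
      obtain ⟨h, hh, eh⟩ := f3 ⟨x.1, m⟩ i hx
      refine ⟨h, hh, ?_⟩
      filter_upwards [eh, V.isOpen.mem_nhds m] with y h1 h2 hy
      exact h1 h2

/-- The presheaf `U ↦ Γ(U, L ⊗ 𝒥)`. -/
def LineBundle.presheaf (L : LineBundle A) (J : GermFamily A) :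
    TopCat.Presheaf AddCommGrpCat.{u} (TopCat.of X) where
  obj U := AddCommGrpCat.of (L.sections J U.unop)
  map {U V} k := AddCommGrpCat.ofHom
    { toFun := fun f => ⟨fun x => f.1 ⟨x.1, k.unop.le x.2⟩, (L.localPredicate J).res k.unop f.1 f.2⟩
      map_zero' := rfl
      map_add' := fun _ _ => rfl }

lemma LineBundle.presheaf_isSheaf (L : LineBundle A) (J : GermFamily A) :
    (L.presheaf J).IsSheaf := by
  rw [TopCat.Presheaf.isSheaf_iff_isSheaf_comp' (forget AddCommGrpCat)]
  exact TopCat.Presheaf.isSheaf_of_iso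
    (NatIso.ofComponents (fun U => Iso.refl _) (fun _ => rfl) :
      TopCat.subpresheafToTypes (L.localPredicate J).toPrelocalPredicate ≅
        L.presheaf J ⋙ forget AddCommGrpCat)
    (TopCat.subpresheafToTypes.isSheaf (L.localPredicate J))

/-- The sheaf `L ⊗ 𝒥` of abelian groups on `X`. -/
def LineBundle.twist (L : LineBundle A) (J : GermFamily A) :
    Sheaf (Opens.grothendieckTopology X) AddCommGrpCat.{u} :=
  ⟨L.presheaf J, L.presheaf_isSheaf J⟩

/-- The multiplication `L ⊗ 𝒥 → L' ⊗ 𝒥'` by a section `s` of `M`, where `L' = L ⊗ M` and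
`s 𝒥 ⊆ 𝒥'`. -/
def LineBundle.mulSection {L L' M : LineBundle A} {J J' : GermFamily A} (s : M.Section)
    (hL : ∀ i j x, L'.g i j x = L.g i j x * M.g i j x)
    (hJ : ∀ i x, x ∈ (A.chart i).source → ∀ h ∈ J i x, s.toFun i * h ∈ J' i x) :
    L.twist J ⟶ L'.twist J' :=
  ⟨{ app := fun U => AddCommGrpCat.ofHom
      { toFun := fun f => ⟨fun x i => s.toFun i x.1 * f.1 x i, by
          obtain ⟨f1, f2, f3⟩ := f.2
          refine ⟨fun x i hx => by simp [f1 x i hx], fun x i j hi hj => ?_, fun x i hx => ?_⟩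
          · dsimp only
            rw [f2 x i j hi hj, s.compat i j x.1 hi hj, hL]; ring
          · obtain ⟨h, hh, eh⟩ := f3 x i hx
            refine ⟨s.toFun i * h, hJ i x.1 hx h hh, ?_⟩
            filter_upwards [eh] with y h1 hy
            simp [h1 hy]⟩
        map_zero' := by ext; simp
        map_add' := fun a b => by ext; simp [mul_add] }
     naturality := fun _ _ _ => rfl }⟩

/-- The inclusion `L ⊗ 𝒥 → L ⊗ 𝒥'` for `𝒥 ⊆ 𝒥'`. -/
def LineBundle.incl (L : LineBundle A) {J J' : GermFamily A} (hJ : ∀ i x, J i x ≤ J' i x) :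
    L.twist J ⟶ L.twist J' :=
  ⟨{ app := fun U => AddCommGrpCat.ofHom
      { toFun := fun f => ⟨f.1, f.2.1, f.2.2.1, fun x i hx => by
          obtain ⟨h, hh, eh⟩ := f.2.2.2 x i hx
          exact ⟨h, hJ i x.1 hh, eh⟩⟩
        map_zero' := rfl
        map_add' := fun _ _ => rfl }
     naturality := fun _ _ _ => rfl }⟩

end Sheaves

/-! ### The commutative diagram -/

section Diagram

variable {n : ℕ} {X : Type u} [TopologicalSpace X] [ChartedSpace (Fin n → ℂ) X]
  [IsManifold 𝓘(ℂ, Fin n → ℂ) ω X] {A : HolAtlas n X} (P : LogPair A)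

/-- The line bundle `K_X ⊗ D ⊗ F`. -/
def LogPair.logBundle (F : LineBundle A) : LineBundle A :=
  ((canonicalBundle A).tensor P.D.bundle).tensor F

section Left

variable {F : LineBundle A} (φF : Potential F)

/-- The sheaf `K_X ⊗ D ⊗ F ⊗ 𝒥_σ(φ_F; ψ_D)`. -/
def LogPair.adj (σ : ℕ) : Sheaf (Opens.grothendieckTopology X) AddCommGrpCat.{u} :=
  (P.logBundle F).twist (P.adjointIdeal σ φF)

/-- The inclusion `𝒥_σ ⊆ 𝒥_σ'` (tensored with `K_X ⊗ D ⊗ F`). -/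
def LogPair.adjIncl {σ σ' : ℕ} (h : σ ≤ σ') : P.adj φF σ ⟶ P.adj φF σ' :=
  (P.logBundle F).incl fun i x => P.adjointIdeal_mono φF h i x

lemma LogPair.adjIncl_comp {a b c : ℕ} (h : a ≤ b) (h' : b ≤ c) :
    P.adjIncl φF h ≫ P.adjIncl φF h' = P.adjIncl φF (h.trans h') := rfl

/-- The quotient sheaf `K_X ⊗ D ⊗ F ⊗ 𝒥_σ' / 𝒥_σ`. -/
def LogPair.adjQuot {σ σ' : ℕ} (h : σ ≤ σ') : Sheaf (Opens.grothendieckTopology X) AddCommGrpCat.{u} :=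
  cokernel (P.adjIncl φF h)

/-- The residue sheaf `K_X ⊗ D ⊗ F ⊗ ℛ_σ` of index `σ`: the third term of the residue short exact
sequence `0 → 𝒥_{σ-1} → 𝒥_σ → ℛ_σ → 0`. -/
def LogPair.residueSheaf (σ : ℕ) : Sheaf (Opens.grothendieckTopology X) AddCommGrpCat.{u} :=
  P.adjQuot φF (Nat.sub_le σ 1)

/-- The morphism `ℛ_σ = 𝒥_σ / 𝒥_{σ-1} → 𝒥_{σ_mlc} / 𝒥_{σ-1}` induced by the inclusion. -/
def LogPair.residueIncl (σ : ℕ) (h : σ ≤ P.D.mlc) :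
    P.residueSheaf φF σ ⟶ P.adjQuot φF ((Nat.sub_le σ 1).trans h) :=
  cokernel.map _ _ (𝟙 _) (P.adjIncl φF h) (by rw [Category.id_comp, LogPair.adjIncl_comp])

/-- `ι_σ : H^q(K_X ⊗ D ⊗ F ⊗ 𝒥_σ) → H^q(K_X ⊗ D ⊗ F ⊗ 𝒥_{σ_mlc})`. -/
def LogPair.iota (σ : ℕ) (h : σ ≤ P.D.mlc) (q : ℕ) :
    Sheaf.H.{u} (P.adj φF σ) q →+ Sheaf.H.{u} (P.adj φF P.D.mlc) q :=
  Sheaf.H.map (P.adjIncl φF h) q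

/-- `τ_σ : H^q(K_X ⊗ D ⊗ F ⊗ ℛ_σ) → H^q(K_X ⊗ D ⊗ F ⊗ 𝒥_{σ_mlc} / 𝒥_{σ-1})`. -/
def LogPair.tau (σ : ℕ) (h : σ ≤ P.D.mlc) (q : ℕ) :
    Sheaf.H.{u} (P.residueSheaf φF σ) q →+
      Sheaf.H.{u} (P.adjQuot φF ((Nat.sub_le σ 1).trans h)) q :=
  Sheaf.H.map (P.residueIncl φF σ h) q

end Left

section Right

variable {F M : LineBundle A} (φF : Potential F) (φM : Potential M)

/-- The sheaf `K_X ⊗ D ⊗ F ⊗ M ⊗ ℐ(φ_F + φ_M)`. -/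
def LogPair.targetMult : Sheaf (Opens.grothendieckTopology X) AddCommGrpCat.{u} :=
  ((P.logBundle F).tensor M).twist (φF.add φM).multiplierIdeal

/-- The sheaf `K_X ⊗ D ⊗ F ⊗ M ⊗ 𝒥_σ(φ_F + φ_M; ψ_D)`. -/
def LogPair.targetAdj (σ : ℕ) : Sheaf (Opens.grothendieckTopology X) AddCommGrpCat.{u} :=
  ((P.logBundle F).tensor M).twist (P.adjointIdeal σ (φF.add φM))

/-- The inclusion `𝒥_σ(φ_F + φ_M; ψ_D) ⊆ ℐ(φ_F + φ_M)` (tensored with `K_X ⊗ D ⊗ F ⊗ M`). -/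
def LogPair.targetIncl (σ : ℕ) : P.targetAdj φF φM σ ⟶ P.targetMult φF φM :=
  ((P.logBundle F).tensor M).incl fun i x => P.adjointIdeal_le (φF.add φM) σ i x

/-- The quotient sheaf `K_X ⊗ D ⊗ F ⊗ M ⊗ ℐ(φ_F + φ_M) / 𝒥_σ(φ_F + φ_M; ψ_D)`. -/
def LogPair.targetQuot (σ : ℕ) : Sheaf (Opens.grothendieckTopology X) AddCommGrpCat.{u} :=
  cokernel (P.targetIncl φF φM σ)

variable (s : M.Section) (hs : s.IsBounded φM)

/-- Multiplication by `s` from `K_X ⊗ D ⊗ F ⊗ 𝒥_σ(φ_F; ψ_D)` to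
`K_X ⊗ D ⊗ F ⊗ M ⊗ 𝒥_σ(φ_F + φ_M; ψ_D)`. -/
def LogPair.mulAdj (σ : ℕ) : P.adj φF σ ⟶ P.targetAdj φF φM σ :=
  LineBundle.mulSection s (fun _ _ _ => rfl) fun i x hx h hh =>
    P.mul_mem_adjointIdeal φF φM s hs σ i x hx h hh

/-- Multiplication by `s` from `K_X ⊗ D ⊗ F ⊗ 𝒥_{σ_mlc}(φ_F; ψ_D)` to
`K_X ⊗ D ⊗ F ⊗ M ⊗ ℐ(φ_F + φ_M)`. -/
def LogPair.mulMlc : P.adj φF P.D.mlc ⟶ P.targetMult φF φM :=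
  LineBundle.mulSection s (fun _ _ _ => rfl) fun i x hx h hh =>
    φF.mul_mem_multiplierIdeal φM s hs i x hx h (P.adjointIdeal_le φF _ i x hh)

lemma LogPair.mul_comm_incl (σ : ℕ) (h : σ ≤ P.D.mlc) :
    P.adjIncl φF h ≫ P.mulMlc φF φM s hs = P.mulAdj φF φM s hs σ ≫ P.targetIncl φF φM σ := rfl

/-- The morphism induced by `s` on the quotients
`𝒥_{σ_mlc}(φ_F) / 𝒥_σ(φ_F) → ℐ(φ_F + φ_M) / 𝒥_σ(φ_F + φ_M)` (tensored with the bundles). -/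
def LogPair.mulQuot (σ : ℕ) (h : σ ≤ P.D.mlc) : P.adjQuot φF h ⟶ P.targetQuot φF φM σ :=
  cokernel.map _ _ (P.mulAdj φF φM s hs σ) (P.mulMlc φF φM s hs)
    (P.mul_comm_incl φF φM s hs σ h)

/-- `μ_σ : H^q(K_X ⊗ D ⊗ F ⊗ 𝒥_σ) → H^q(K_X ⊗ D ⊗ F ⊗ M ⊗ ℐ(φ_F + φ_M))`, the composition of
`ι_σ` with the multiplication by `s`. -/
def LogPair.mu (σ : ℕ) (h : σ ≤ P.D.mlc) (q : ℕ) :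
    Sheaf.H.{u} (P.adj φF σ) q →+ Sheaf.H.{u} (P.targetMult φF φM) q :=
  (Sheaf.H.map (P.mulMlc φF φM s hs) q).comp (P.iota φF σ h q)

/-- `ν_σ : H^q(K_X ⊗ D ⊗ F ⊗ ℛ_σ) →
H^q(K_X ⊗ D ⊗ F ⊗ M ⊗ ℐ(φ_F + φ_M) / 𝒥_{σ-1}(φ_F + φ_M))`, the composition of `τ_σ` with the
multiplication by `s`. -/
def LogPair.nu (σ : ℕ) (h : σ ≤ P.D.mlc) (q : ℕ) :
    Sheaf.H.{u} (P.residueSheaf φF σ) q →+ Sheaf.H.{u} (P.targetQuot φF φM (σ - 1)) q :=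
  (Sheaf.H.map (P.mulQuot φF φM s hs (σ - 1) ((Nat.sub_le σ 1).trans h)) q).comp
    (P.tau φF σ h q)

end Right

/-- Multiplication `K_X ⊗ D ⊗ F → K_X ⊗ D ⊗ F^{⊗ (m+1)}` by a section `s` of `F^{⊗ m}`. -/
def LogPair.fujinoMul (F : LineBundle A) (m : ℕ) (s : (F.pow m).Section) :
    (P.logBundle F).twist (structureGerms A) ⟶
      (P.logBundle (F.pow (m + 1))).twist (structureGerms A) :=
  LineBundle.mulSection s
    (fun i j x => by simp only [LogPair.logBundle, LineBundle.tensor, LineBundle.pow]; ring)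
    fun i x hx _ hh => AnalyticAt.mul (s.hol i x hx) hh

/-- The multiplication map `H^q(X, K_X ⊗ D ⊗ F) → H^q(X, K_X ⊗ D ⊗ F^{⊗ (m+1)})` by a section `s`
of `F^{⊗ m}`. -/
def LogPair.fujinoMap (F : LineBundle A) (m : ℕ) (s : (F.pow m).Section) (q : ℕ) :
    Sheaf.H.{u} ((P.logBundle F).twist (structureGerms A)) q →+
      Sheaf.H.{u} ((P.logBundle (F.pow (m + 1))).twist (structureGerms A)) q :=
  Sheaf.H.map (P.fujinoMul F m s) q

end Diagram

end AdjointInjectivity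

end

noncomputable section

namespace AdjointInjectivity

/-! ### Cohomology of a subsheaf and its quotient. -/

section Cohomology

variable {n : ℕ} {X : Type u} [TopologicalSpace X] [ChartedSpace (Fin n → ℂ) X]
  {A : HolAtlas n X}

/-! The first statement is a diagram chase, by induction on `σ`, for the claim `ker μ_σ = ker ι_σ`.
Let `μ_σ x = 0` with `σ ≥ 1`. The class of `x` in the cohomology of `ℛ_σ` is killed by `ν_σ`, hence
by `τ_σ`, so `ι_σ x` dies in the cohomology of `𝒥_{σ_mlc} / 𝒥_{σ-1}`. By exactness `ι_σ x = ι_{σ-1}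
y` for some `y`. Multiplication by `s` gives `μ_{σ-1} y = μ_σ x = 0`, so the induction hypothesis
yields `ι_{σ-1} y = 0`, that is, `ι_σ x = 0`. For `σ = σ_mlc` the map `ι_σ` is the identity, and the
claim becomes injectivity. The chase is `LogPair.ker_mu_eq_ker_iota`; its only homological input is
`exists_map_eq_of_map_cokernel_eq_zero`.

For the second statement, smoothness of `m φ_F` with `m ≥ 1` makes `φ_F` smooth. It then has to be
seen that `𝒥_{σ_mlc}(φ_F)` and `ℐ(φ_F + m φ_F)` are both the structure sheaf, so that `μ_{σ_mlc}` is
the multiplication map in question (`LogPair.injective_fujinoMap`).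

This is an integrability statement (`LogPair.structureGerms_le_adjointIdeal`). If `p ≤ σ_mlc`
components of `D` pass through a point, the weight there is bounded by a multiple of `∏ |w_j|⁻² /
(t^p (log (e t))^{1+ε})` with `t = 1 + ∑ |log |w_j|²|`. In polar coordinates `|w|⁻²` times Lebesgue
measure is, up to a constant, `dt dθ`, so each integration over a disc lowers the power of `t` by
one. The last one is the integral of `1 / (t (log (e t))^{1+ε})`, which converges because `ε > 0`
(`lintegral_unitDisc_logWeight_le`, `lintegral_polydisc_lt_top`). -/

instance LineBundle.mono_incl (L : LineBundle A) {J J' : GermFamily A}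
    (hJ : ∀ i x, J i x ≤ J' i x) : Mono (L.incl hJ) := by
  have : ∀ U, Mono ((L.incl hJ).hom.app U) := fun U => by
    rw [AddCommGrpCat.mono_iff_injective]
    intro a b hab
    exact Subtype.ext (congrArg (fun f : L.sections J' U.unop => f.1) hab)
  have : Mono (L.incl hJ).hom := NatTrans.mono_of_mono_app _
  exact Sheaf.Hom.mono_of_presheaf_mono _ _ _

/-- Exactness of `H^q(𝒜) → H^q(ℬ) → H^q(ℬ / 𝒜)` for a subsheaf `𝒜 ⊆ ℬ`. -/
lemma exists_map_eq_of_map_cokernel_eq_zero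
    {S T : Sheaf (Opens.grothendieckTopology X) AddCommGrpCat.{u}} (f : S ⟶ T) [Mono f] (q : ℕ)
    (x : Sheaf.H.{u} T q) (hx : Sheaf.H.map (cokernel.π f) q x = 0) :
    ∃ y : Sheaf.H.{u} S q, Sheaf.H.map f q y = x := by
  let C := ShortComplex.mk f (cokernel.π f) (cokernel.condition f)
  have hC : C.ShortExact :=
    { exact := ShortComplex.exact_of_g_is_cokernel C (cokernelIsCokernel f)
      mono_f := ‹_›
      epi_g := inferInstanceAs (Epi (cokernel.π f)) }
  exact Abelian.Ext.covariant_sequence_exact₂ _ hC x hx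

/-- A morphism of sheaves with a left inverse is injective on cohomology. -/
lemma map_injective_of_comp_eq_id
    {S T : Sheaf (Opens.grothendieckTopology X) AddCommGrpCat.{u}} (f : S ⟶ T) (g : T ⟶ S)
    (h : f ≫ g = 𝟙 S) (q : ℕ) : Function.Injective (Sheaf.H.map f q : Sheaf.H.{u} S q → _) := by
  refine Function.LeftInverse.injective (g := Sheaf.H.map g q) fun x => ?_
  rw [← Sheaf.H.map_comp_apply, h, Sheaf.H.map_id_apply]

lemma map_map_eq_map_map {S T T' U : Sheaf (Opens.grothendieckTopology X) AddCommGrpCat.{u}}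
    (f : S ⟶ T) (g : T ⟶ U) (f' : S ⟶ T') (g' : T' ⟶ U) (h : f ≫ g = f' ≫ g') (q : ℕ)
    (x : Sheaf.H.{u} S q) :
    Sheaf.H.map g q (Sheaf.H.map f q x) = Sheaf.H.map g' q (Sheaf.H.map f' q x) := by
  rw [← Sheaf.H.map_comp_apply, h, Sheaf.H.map_comp_apply]

end Cohomology

/-! ### The induction on the index of the adjoint ideals. -/

section DiagramChase

variable {n : ℕ} {X : Type u} [TopologicalSpace X] [ChartedSpace (Fin n → ℂ) X]
  [IsManifold 𝓘(ℂ, Fin n → ℂ) ω X] {A : HolAtlas n X} (P : LogPair A)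
  {F M : LineBundle A} (φF : Potential F) (φM : Potential M) (s : M.Section)
  (hs : s.IsBounded φM) (q : ℕ)

lemma LogPair.mu_eq (σ : ℕ) (h : σ ≤ P.D.mlc) (x : Sheaf.H.{u} (P.adj φF σ) q) :
    P.mu φF φM s hs σ h q x = Sheaf.H.map (P.mulMlc φF φM s hs) q (P.iota φF σ h q x) := rfl

/-- The projection `𝒥_σ' → 𝒥_σ' / 𝒥_σ`. -/
def LogPair.adjQuotProj {σ σ' : ℕ} (h : σ ≤ σ') : P.adj φF σ' ⟶ P.adjQuot φF h :=
  cokernel.π (P.adjIncl φF h)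

/-- The projection `𝒥_σ → ℛ_σ`. -/
def LogPair.residueProj (σ : ℕ) : P.adj φF σ ⟶ P.residueSheaf φF σ :=
  cokernel.π (P.adjIncl φF (Nat.sub_le σ 1))

/-- The projection `ℐ(φ_F + φ_M) → ℐ(φ_F + φ_M) / 𝒥_σ(φ_F + φ_M; ψ_D)`. -/
def LogPair.targetProj (σ : ℕ) : P.targetMult φF φM ⟶ P.targetQuot φF φM σ :=
  cokernel.π (P.targetIncl φF φM σ)

/-- Exactness in the middle for `0 → 𝒥_σ → 𝒥_{σ_mlc} → 𝒥_{σ_mlc} / 𝒥_σ → 0`. It lets the chase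
descend from one index to the previous one. -/
lemma LogPair.exists_iota_eq (σ : ℕ) (h : σ ≤ P.D.mlc) (x : Sheaf.H.{u} (P.adj φF P.D.mlc) q)
    (hx : Sheaf.H.map (P.adjQuotProj φF h) q x = 0) : ∃ y, P.iota φF σ h q y = x :=
  haveI : Mono (P.adjIncl φF h) := LineBundle.mono_incl _ _
  exists_map_eq_of_map_cokernel_eq_zero _ q x hx

/-- `τ_σ` is compatible with `ι_σ`. -/
lemma LogPair.tau_map_residueProj (σ : ℕ) (h : σ ≤ P.D.mlc)
    (x : Sheaf.H.{u} (P.adj φF σ) q) :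
    P.tau φF σ h q (Sheaf.H.map (P.residueProj φF σ) q x) =
      Sheaf.H.map (P.adjQuotProj φF ((Nat.sub_le σ 1).trans h)) q (P.iota φF σ h q x) :=
  map_map_eq_map_map _ _ _ _ (cokernel.π_desc _ _ _) q x

/-- `ν_σ` is compatible with `μ_σ`. -/
lemma LogPair.nu_map_residueProj (σ : ℕ) (h : σ ≤ P.D.mlc)
    (x : Sheaf.H.{u} (P.adj φF σ) q) :
    P.nu φF φM s hs σ h q (Sheaf.H.map (P.residueProj φF σ) q x) =
      Sheaf.H.map (P.targetProj φF φM (σ - 1)) q (P.mu φF φM s hs σ h q x) :=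
  (congrArg (Sheaf.H.map (P.mulQuot φF φM s hs (σ - 1) ((Nat.sub_le σ 1).trans h)) q)
    (P.tau_map_residueProj φF q σ h x)).trans
    (map_map_eq_map_map _ _ _ _ (cokernel.π_desc _ _ _) q _)

/-- `ker μ_σ = ker ι_σ` for all `σ` as soon as this holds for `σ = 0` and `ker ν_σ = ker τ_σ` for
all `σ ≥ 1`. -/
lemma LogPair.ker_mu_eq_ker_iota
    (h0 : (P.mu φF φM s hs 0 (Nat.zero_le _) q).ker = (P.iota φF 0 (Nat.zero_le _) q).ker)
    (hν : ∀ (σ : ℕ) (_ : 1 ≤ σ) (h : σ ≤ P.D.mlc),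
      (P.nu φF φM s hs σ h q).ker = (P.tau φF σ h q).ker) (σ : ℕ) (h : σ ≤ P.D.mlc) :
    (P.mu φF φM s hs σ h q).ker = (P.iota φF σ h q).ker := by
  induction σ with
  | zero => exact h0
  | succ σ ih =>
    have hle : σ ≤ P.D.mlc := (Nat.le_succ σ).trans h
    refine le_antisymm (fun x hx => ?_) (fun x hx => ?_)
    · rw [AddMonoidHom.mem_ker] at hx ⊢
      -- Pass to the residue class of `x`: it lies in `ker ν = ker τ`, so the image of `x` in
      -- `𝒥_{σ_mlc}` vanishes modulo `𝒥_σ`.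
      have h1 := P.nu_map_residueProj φF φM s hs q (σ + 1) h x
      rw [hx, map_zero, ← AddMonoidHom.mem_ker, hν (σ + 1) (Nat.succ_pos σ) h,
        AddMonoidHom.mem_ker, P.tau_map_residueProj] at h1
      obtain ⟨y, hy⟩ := P.exists_iota_eq φF q _ _ _ h1
      -- The index `σ + 1 - 1` coming from the residue sheaf is definitionally `σ`, which brings `y`
      -- within reach of the induction hypothesis.
      have hy' : P.iota φF σ hle q y = P.iota φF (σ + 1) h q x := hy
      -- Since `μ` factors through `ι`, the classes `x` and `y`, which have the same image under
      -- `ι`, also have the same image under `μ`.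
      rw [← hy', ← AddMonoidHom.mem_ker, ← ih hle, AddMonoidHom.mem_ker, P.mu_eq, hy',
        ← P.mu_eq, hx]
    · rw [AddMonoidHom.mem_ker] at hx ⊢
      rw [P.mu_eq, hx, map_zero]

lemma LogPair.iota_mlc (x : Sheaf.H.{u} (P.adj φF P.D.mlc) q) :
    P.iota φF P.D.mlc le_rfl q x = x :=
  Sheaf.H.map_id_apply x

/-- If `ker μ_0 = ker ι_0` and `ker ν_σ = ker τ_σ` for all `σ ≥ 1`, then `μ_{σ_mlc}` is
injective. -/
lemma LogPair.injective_mu_mlc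
    (h0 : (P.mu φF φM s hs 0 (Nat.zero_le _) q).ker = (P.iota φF 0 (Nat.zero_le _) q).ker)
    (hν : ∀ (σ : ℕ) (_ : 1 ≤ σ) (h : σ ≤ P.D.mlc),
      (P.nu φF φM s hs σ h q).ker = (P.tau φF σ h q).ker) :
    Function.Injective (P.mu φF φM s hs P.D.mlc le_rfl q) := by
  rw [injective_iff_map_eq_zero]
  intro x hx
  rw [← AddMonoidHom.mem_ker, P.ker_mu_eq_ker_iota φF φM s hs q h0 hν _ le_rfl,
    AddMonoidHom.mem_ker, P.iota_mlc] at hx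
  exact hx

end DiagramChase

/-! ### From `μ_{σ_mlc}` to multiplication by `s` on the untwisted sheaves. -/

section Fujino

variable {n : ℕ} {X : Type u} [TopologicalSpace X] [ChartedSpace (Fin n → ℂ) X]
  {A : HolAtlas n X}

/-- The inclusion `L ⊗ 𝒥 → L' ⊗ 𝒥'` for `𝒥 ⊆ 𝒥'` and bundles with the same transition
functions. -/
def LineBundle.inclOfEq {L L' : LineBundle A} {J J' : GermFamily A}
    (hL : ∀ i j x, L'.g i j x = L.g i j x) (hJ : ∀ i x, J i x ≤ J' i x) :
    L.twist J ⟶ L'.twist J' :=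
  ⟨{ app := fun U => AddCommGrpCat.ofHom
      { toFun := fun f => ⟨f.1, f.2.1, fun x i j hi hj => by
          rw [hL]; exact f.2.2.1 x i j hi hj, fun x i hx => by
          obtain ⟨h, hh, eh⟩ := f.2.2.2 x i hx
          exact ⟨h, hJ i x.1 hh, eh⟩⟩
        map_zero' := rfl
        map_add' := fun _ _ => rfl }
     naturality := fun _ _ _ => rfl }⟩

/-- The inclusion in the other direction is a left inverse. Working with morphisms instead of
equalities of sheaves avoids transport along `F ⊗ F^{⊗ m} = F^{⊗ (m+1)}`, which holds only after
rewriting transition functions. -/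
lemma LineBundle.injective_map_inclOfEq {L L' : LineBundle A} {J J' : GermFamily A}
    (hL : ∀ i j x, L'.g i j x = L.g i j x) (hJ : ∀ i x, J i x ≤ J' i x)
    (hJ' : ∀ i x, J' i x ≤ J i x) (q : ℕ) :
    Function.Injective (Sheaf.H.map (LineBundle.inclOfEq hL hJ) q :
      Sheaf.H.{u} (L.twist J) q → _) :=
  map_injective_of_comp_eq_id _
    (LineBundle.inclOfEq (fun i j x => (hL i j x).symm) hJ') rfl q

/-- If `𝒥_{σ_mlc}(φ_F) = 𝒪_X`, the injectivity of `μ_{σ_mlc}` implies that of multiplication by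
`s`. -/
lemma LogPair.injective_fujinoMap [IsManifold 𝓘(ℂ, Fin n → ℂ) ω X] (P : LogPair A)
    {F : LineBundle A} (φF : Potential F) {m : ℕ} (φM : Potential (F.pow m))
    (s : (F.pow m).Section) (hs : s.IsBounded φM) (q : ℕ)
    (hJ : ∀ i x, structureGerms A i x ≤ P.adjointIdeal P.D.mlc φF i x)
    (hμ : Function.Injective (P.mu φF φM s hs P.D.mlc le_rfl q))
    (hI : ∀ i x, structureGerms A i x ≤ (φF.add φM).multiplierIdeal i x) :
    Function.Injective (P.fujinoMap F m s q) := by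
  -- All the maps involved act on families of functions by the identity or by multiplication with
  -- `s`, hence the factorisation holds definitionally.
  have e : P.fujinoMul F m s =
      LineBundle.inclOfEq (L' := P.logBundle F) (J' := P.adjointIdeal P.D.mlc φF)
        (fun _ _ _ => rfl) hJ ≫ P.mulMlc φF φM s hs ≫
      LineBundle.inclOfEq (L' := P.logBundle (F.pow (m + 1))) (J' := structureGerms A)
        (fun i j x => by simp only [LogPair.logBundle, LineBundle.tensor, LineBundle.pow]; ring)
        (fun i x h hh => hh.1) := rfl
  have hμ' : Function.Injective (Sheaf.H.map (P.mulMlc φF φM s hs) q :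
      Sheaf.H.{u} (P.adj φF P.D.mlc) q → _) := fun a b hab => hμ (by
    rw [P.mu_eq, P.mu_eq, P.iota_mlc, P.iota_mlc, hab])
  have h1 := LineBundle.injective_map_inclOfEq (L' := P.logBundle F)
    (J' := P.adjointIdeal P.D.mlc φF) (fun _ _ _ => rfl) hJ (fun i x h hh => hh.1) q
  have h3 := LineBundle.injective_map_inclOfEq (L := (P.logBundle F).tensor (F.pow m))
    (L' := P.logBundle (F.pow (m + 1))) (J := (φF.add φM).multiplierIdeal)
    (J' := structureGerms A)
    (fun i j x => by simp only [LogPair.logBundle, LineBundle.tensor, LineBundle.pow]; ring)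
    (fun i x h hh => hh.1) hI q
  have e' : ∀ a, P.fujinoMap F m s q a = _ := fun a =>
    (congrArg (fun f => Sheaf.H.map f q a) e).trans ((Sheaf.H.map_comp_apply _ _ a).trans
      (Sheaf.H.map_comp_apply (P.mulMlc φF φM s hs) _ _))
  exact fun a b hab => h1 (hμ' (h3 ((e' a).symm.trans (hab.trans (e' b)))))

end Fujino

/-! ### Integrability of the model weight on a polydisc. -/

section Integrals

/-- Iterated integration of a product of functions of one variable against a function of a sum. -/
lemma lintegral_prod_mul_sum_le {ι : Type*} [Fintype ι] (G : ℕ → ℝ → ℝ≥0∞)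
    (hG : ∀ p, Measurable (G p)) (e : ι → ℕ) (d : ι → ℂ → ℝ≥0∞) (hd : ∀ j, Measurable (d j))
    (r : ι → ℂ → ℝ) (hr : ∀ j, Measurable (r j)) (hr0 : ∀ j w, 0 ≤ r j w) (C : ℝ≥0∞)
    (hC : ∀ j p T, 1 ≤ T → ∫⁻ w, d j w * G (p + e j) (T + r j w) ≤ C * G p T) :
    ∫⁻ w : ι → ℂ, (∏ j, d j (w j)) * G (∑ j, e j) (1 + ∑ j, r j (w j)) ≤
      C ^ Fintype.card ι * G 0 1 := by
  classical
  have hm : ∀ (s : Finset ι) (p : ℕ), Measurable fun w : ι → ℂ =>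
      (∏ j ∈ s, d j (w j)) * G p (1 + ∑ j ∈ s, r j (w j)) := fun s p => by
    have := hG p
    fun_prop
  -- Induct on the set of variables still to be integrated; each integration costs one factor `C`
  -- and removes `e i` from the index of `G`.
  have key : ∀ s : Finset ι, ∀ x : ι → ℂ,
      (∫⋯∫⁻_s, (fun w : ι → ℂ => (∏ j ∈ s, d j (w j)) *
        G (∑ j ∈ s, e j) (1 + ∑ j ∈ s, r j (w j))) ∂fun _ => volume) x ≤
      C ^ s.card * G 0 1 := by
    intro s
    induction s using Finset.induction with
    | empty => simp
    | insert i s hi ih =>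
      intro x
      rw [lmarginal_insert' _ (hm _ _) hi]
      -- The variable `i` is integrated innermost. The others are frozen, so `hC` applies with `T =
      -- 1 + ∑ j ∈ s, r j (w j)`, which is at least `1` because the `r j` are nonnegative.
      have h1 : (fun x : ι → ℂ => ∫⁻ xi, (∏ j ∈ insert i s, d j (Function.update x i xi j)) *
          G (∑ j ∈ insert i s, e j) (1 + ∑ j ∈ insert i s, r j (Function.update x i xi j))) ≤
          fun w => C * ((∏ j ∈ s, d j (w j)) * G (∑ j ∈ s, e j) (1 + ∑ j ∈ s, r j (w j))) := by
        intro w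
        have hne : ∀ xi, ∀ j ∈ s, Function.update w i xi j = w j := fun xi j hj =>
          Function.update_of_ne (ne_of_mem_of_not_mem hj hi) _ _
        have h2 : ∀ xi, (∏ j ∈ insert i s, d j (Function.update w i xi j)) *
            G (∑ j ∈ insert i s, e j) (1 + ∑ j ∈ insert i s, r j (Function.update w i xi j)) =
            (∏ j ∈ s, d j (w j)) * (d i xi *
              G (∑ j ∈ s, e j + e i) (1 + ∑ j ∈ s, r j (w j) + r i xi)) := fun xi => by
          have h3 : ∏ j ∈ s, d j (Function.update w i xi j) = ∏ j ∈ s, d j (w j) :=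
            Finset.prod_congr rfl fun j hj => by rw [hne xi j hj]
          have h4 : ∑ j ∈ s, r j (Function.update w i xi j) = ∑ j ∈ s, r j (w j) :=
            Finset.sum_congr rfl fun j hj => by rw [hne xi j hj]
          rw [Finset.prod_insert hi, Finset.sum_insert hi, Finset.sum_insert hi,
            Function.update_self, h3, h4, add_comm (e i), add_comm (r i xi), ← add_assoc,
            mul_comm (d i xi), mul_assoc]
        simp only [h2]
        rw [lintegral_const_mul _ (by have := hG (∑ j ∈ s, e j + e i); have := hd i; fun_prop)]
        calc _ ≤ (∏ j ∈ s, d j (w j)) * (C * G (∑ j ∈ s, e j) (1 + ∑ j ∈ s, r j (w j))) := by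
              gcongr
              exact hC i _ _ (by linarith [Finset.sum_nonneg fun j (_ : j ∈ s) => hr0 j (w j)])
          _ = _ := by ring
      refine (lmarginal_mono h1 x).trans ?_
      rw [Finset.card_insert_of_notMem hi, pow_succ']
      unfold lmarginal at ih ⊢
      rw [mul_assoc]
      refine (lintegral_const_mul C ((hm s (∑ j ∈ s, e j)).comp
        (measurable_updateFinset (x := x)))).le.trans ?_
      gcongr
      exact ih x
  have h := key Finset.univ 0
  rw [← lintegral_eq_lmarginal_univ] at h
  exact h

/-- A radial integral over the punctured unit disc with a pole of order two at the origin. -/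
lemma lintegral_unitDisc_le (k u : ℝ → ℝ) (hk : Measurable k) (T : ℝ)
    (hk0 : ∀ t, T ≤ t → 0 ≤ k t) (hu0 : ∀ t, T ≤ t → 0 ≤ u t)
    (hu : ∀ t, T ≤ t → HasDerivAt u (-k t) t) :
    ∫⁻ w : ℂ, (Metric.ball (0 : ℂ) 1).indicator (fun w => (‖w‖ₑ ^ 2)⁻¹) w *
      ENNReal.ofReal (k (T + |Real.log (‖w‖ ^ 2)|)) ≤ ENNReal.ofReal (Real.pi * u T) := by
  have hlog : ∀ ρ ∈ Set.Ioc (0 : ℝ) 1, |Real.log (ρ ^ 2)| = -2 * Real.log ρ := fun ρ hρ => by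
    rw [Real.log_pow, abs_of_nonpos]
    · push_cast; ring
    · exact mul_nonpos_of_nonneg_of_nonpos (by simp) (Real.log_nonpos hρ.1.le hρ.2)
  -- This is the derivative of `ρ ↦ u (T - 2 log ρ)`, so its integral over `(δ, 1]` is `u T - u (T -
  -- 2 log δ)`, at most `u T`.
  set f : ℝ → ℝ := fun ρ => 2 * ρ⁻¹ * k (T - 2 * Real.log ρ) with hf
  have hfm : Measurable f := by fun_prop
  have h1 : ∀ δ ∈ Set.Ioo (0 : ℝ) 1,
      ∫⁻ ρ in Set.Ioc δ 1, ENNReal.ofReal (f ρ) ≤ ENNReal.ofReal (u T) := by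
    intro δ hδ
    have hT : ∀ ρ ∈ Set.Icc δ 1, T ≤ T - 2 * Real.log ρ := fun ρ hρ => by
      linarith [Real.log_nonpos (hδ.1.le.trans hρ.1) hρ.2]
    have hder : ∀ ρ ∈ Set.Icc δ 1, HasDerivAt (fun ρ => u (T - 2 * Real.log ρ)) (f ρ) ρ := by
      intro ρ hρ
      have hρ0 : ρ ≠ 0 := (hδ.1.trans_le hρ.1).ne'
      have h := (hu _ (hT ρ hρ)).comp ρ (((Real.hasDerivAt_log hρ0).const_mul 2).const_sub T)
      refine h.congr_deriv ?_
      simp only [hf]; ring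
    have hpos : ∀ ρ ∈ Set.Icc δ 1, 0 ≤ f ρ := fun ρ hρ =>
      mul_nonneg (mul_nonneg zero_le_two (inv_nonneg.2 (hδ.1.le.trans hρ.1))) (hk0 _ (hT ρ hρ))
    have hcont : ContinuousOn (fun ρ => u (T - 2 * Real.log ρ)) (Set.Icc δ 1) := fun ρ hρ =>
      (hder ρ hρ).continuousAt.continuousWithinAt
    -- No separate bound on `f` is needed: a nonnegative derivative of a function continuous up to
    -- the endpoints is integrable.
    have hint : IntegrableOn f (Set.Ioc δ 1) :=
      intervalIntegral.integrableOn_deriv_of_nonneg hcont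
        (fun ρ hρ => hder ρ (Set.Ioo_subset_Icc_self hρ))
        fun ρ hρ => hpos ρ (Set.Ioo_subset_Icc_self hρ)
    rw [← ofReal_integral_eq_lintegral_ofReal hint
      ((ae_restrict_iff' measurableSet_Ioc).2 (Filter.Eventually.of_forall fun ρ hρ =>
        hpos ρ (Set.Ioc_subset_Icc_self hρ))), ← intervalIntegral.integral_of_le hδ.2.le,
      intervalIntegral.integral_eq_sub_of_hasDerivAt_of_le hδ.2.le hcont
        (fun ρ hρ => hder ρ (Set.Ioo_subset_Icc_self hρ))
        ((intervalIntegrable_iff_integrableOn_Ioc_of_le hδ.2.le).2 hint)]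
    refine ENNReal.ofReal_le_ofReal ?_
    have := hu0 _ (hT δ (Set.left_mem_Icc.2 hδ.2.le))
    simpa using this
  have h2 : ∫⁻ ρ in Set.Ioc (0 : ℝ) 1, ENNReal.ofReal (f ρ) ≤ ENNReal.ofReal (u T) := by
    -- Exhaust by intervals bounded away from the pole; the shift by `2` keeps the left endpoint
    -- below `1` also for `m = 0`.
    have hU : Set.Ioc (0 : ℝ) 1 = ⋃ m : ℕ, Set.Ioc (1 / ((m : ℝ) + 2)) 1 := by
      ext ρ
      simp only [Set.mem_Ioc, Set.mem_iUnion]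
      constructor
      · rintro ⟨h0, h1⟩
        obtain ⟨m, hm⟩ := exists_nat_one_div_lt h0
        exact ⟨m, (one_div_le_one_div_of_le (by positivity) (by linarith)).trans_lt hm, h1⟩
      · rintro ⟨m, h0, h1⟩
        exact ⟨lt_trans (by positivity) h0, h1⟩
    rw [hU, setLIntegral_iUnion_of_directed]
    · refine iSup_le fun m => h1 _ ⟨by positivity, ?_⟩
      rw [div_lt_one (by positivity)]
      have : (0 : ℝ) ≤ m := m.cast_nonneg
      linarith
    · refine Monotone.directed_le fun a b hab => Set.Ioc_subset_Ioc_left ?_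
      have : (a : ℝ) ≤ b := by exact_mod_cast hab
      exact one_div_le_one_div_of_le (by positivity) (by linarith)
  -- The polar Jacobian `ρ` against the pole `ρ⁻²` leaves `ρ⁻¹`, whence `f ρ / 2`. The angular
  -- integral `2π` turns this half into the constant `π`.
  have h3 : ∀ q ∈ polarCoord.target, ENNReal.ofReal q.1 •
      ((Metric.ball (0 : ℂ) 1).indicator (fun w => (‖w‖ₑ ^ 2)⁻¹) (Complex.polarCoord.symm q) *
        ENNReal.ofReal (k (T + |Real.log (‖Complex.polarCoord.symm q‖ ^ 2)|))) ≤
      (Set.Ioc (0 : ℝ) 1).indicator (fun ρ => ENNReal.ofReal (f ρ / 2)) q.1 := by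
    rintro ⟨ρ, θ⟩ ⟨hρ, -⟩
    have hρ : 0 < ρ := hρ
    have hn : ‖Complex.polarCoord.symm (ρ, θ)‖ = ρ := by
      rw [Complex.norm_polarCoord_symm, abs_of_pos hρ]
    have hn' : ‖Complex.polarCoord.symm (ρ, θ)‖ₑ = ENNReal.ofReal ρ := by
      rw [← ofReal_norm, hn]
    by_cases h : ρ < 1
    · rw [Set.indicator_of_mem (by rwa [mem_ball_zero_iff, hn]),
        Set.indicator_of_mem (show ρ ∈ Set.Ioc (0 : ℝ) 1 from ⟨hρ, h.le⟩), hn, hn',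
        hlog ρ ⟨hρ, h.le⟩, ← ENNReal.ofReal_pow hρ.le, ← ENNReal.ofReal_inv_of_pos (by positivity),
        smul_eq_mul, ← mul_assoc, ← ENNReal.ofReal_mul hρ.le, ← ENNReal.ofReal_mul (by positivity)]
      refine le_of_eq (congrArg _ ?_)
      simp only [hf, neg_mul, ← sub_eq_add_neg]
      field_simp
    · rw [Set.indicator_of_notMem (by rwa [mem_ball_zero_iff, hn])]
      simp
  rw [← Complex.lintegral_comp_polarCoord_symm]
  refine (setLIntegral_mono' polarCoord.open_target.measurableSet h3).trans ?_
  have hm : Measurable fun ρ : ℝ =>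
      (Set.Ioc (0 : ℝ) 1).indicator (fun ρ => ENNReal.ofReal (f ρ / 2)) ρ :=
    Measurable.indicator (by fun_prop) measurableSet_Ioc
  rw [polarCoord_target, Measure.volume_eq_prod, ← Measure.prod_restrict,
    lintegral_prod (fun q : ℝ × ℝ => (Set.Ioc (0 : ℝ) 1).indicator (fun ρ => ENNReal.ofReal (f ρ / 2)) q.1)
      (hm.comp measurable_fst).aemeasurable]
  simp only [lintegral_const, Measure.restrict_apply MeasurableSet.univ, Set.univ_inter,
    Real.volume_Ioo]
  rw [lintegral_mul_const _ hm, lintegral_indicator measurableSet_Ioc,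
    Measure.restrict_restrict measurableSet_Ioc,
    Set.inter_eq_left.2 (Set.Ioc_subset_Ioi_self : Set.Ioc (0 : ℝ) 1 ⊆ Set.Ioi 0)]
  have h4 : ∀ ρ, ENNReal.ofReal (f ρ / 2) = ENNReal.ofReal (f ρ) * ENNReal.ofReal (1 / 2) :=
    fun ρ => by rw [← ENNReal.ofReal_mul' (by norm_num), mul_one_div]
  simp only [h4]
  rw [lintegral_mul_const _ (by fun_prop), mul_assoc, ← ENNReal.ofReal_mul (by norm_num)]
  have hπ := Real.pi_pos
  calc _ ≤ ENNReal.ofReal (u T) * ENNReal.ofReal (1 / 2 * (Real.pi - -Real.pi)) := by gcongr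
    _ = _ := by
      rw [← ENNReal.ofReal_mul (hu0 T le_rfl)]
      ring_nf

/-- The function `1 / (t^p (log (e t))^{1+ε})` for `p ≥ 1`, and `1` for `p = 0`. -/
def logWeight (ε : ℝ) (p : ℕ) (t : ℝ) : ℝ≥0∞ :=
  if p = 0 then 1 else ENNReal.ofReal (t ^ p * Real.log (Real.exp 1 * t) ^ (1 + ε))⁻¹

lemma measurable_logWeight (ε : ℝ) (p : ℕ) : Measurable (logWeight ε p) := by
  unfold logWeight
  split_ifs <;> fun_prop

/-- Needed on `D`, where the pole factor is `⊤`: a vanishing second factor would make the product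
`0`. -/
lemma logWeight_ne_zero (ε : ℝ) (p : ℕ) {t : ℝ} (ht : 1 ≤ t) : logWeight ε p t ≠ 0 := by
  unfold logWeight
  split_ifs
  · exact one_ne_zero
  · have := one_le_log_exp ht
    exact (ENNReal.ofReal_pos.2 (by positivity)).ne'

lemma ofReal_le_logWeight {ε : ℝ} (hε : 0 < ε) (p : ℕ) {t : ℝ} (ht : 1 ≤ t) :
    ENNReal.ofReal (t ^ p * Real.log (Real.exp 1 * t) ^ (1 + ε))⁻¹ ≤ logWeight ε p t := by
  unfold logWeight
  split_ifs with hp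
  · rw [hp, pow_zero, one_mul, ENNReal.ofReal_le_one]
    exact inv_le_one_of_one_le₀ (Real.one_le_rpow (one_le_log_exp ht) (by linarith))
  · exact le_rfl

lemma hasDerivAt_log_exp_mul {t : ℝ} (ht : 0 < t) :
    HasDerivAt (fun t => Real.log (Real.exp 1 * t)) t⁻¹ t := by
  have h := ((hasDerivAt_id t).const_mul (Real.exp 1)).log (by positivity)
  refine h.congr_deriv ?_
  simp only [id]
  field_simp

/-- The one-variable step of the recursion. From exponent `1` to `0` the integral leaves `(log (e
T))^{-ε} / ε`, which is bounded but not by `(log (e T))^{-(1+ε)}`; this is why `logWeight` is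
constant for `p = 0`. The factor `1 + 1 / ε` serves this case and the case `p ≥ 1`, where `1 / p ≤
1` suffices. -/
lemma lintegral_unitDisc_logWeight_le {ε : ℝ} (hε : 0 < ε) (p : ℕ) {T : ℝ} (hT : 1 ≤ T) :
    ∫⁻ w : ℂ, (Metric.ball (0 : ℂ) 1).indicator (fun w => (‖w‖ₑ ^ 2)⁻¹) w *
      logWeight ε (p + 1) (T + |Real.log (‖w‖ ^ 2)|) ≤
      ENNReal.ofReal (Real.pi * (1 + 1 / ε)) * logWeight ε p T := by
  have hπ := Real.pi_pos
  rcases Nat.eq_zero_or_pos p with rfl | hp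
  · have h := lintegral_unitDisc_le
      (fun t => (t ^ 1 * Real.log (Real.exp 1 * t) ^ (1 + ε))⁻¹)
      (fun t => Real.log (Real.exp 1 * t) ^ (-ε) / ε) (by fun_prop) T
      (fun t ht => by have := one_le_log_exp (hT.trans ht); have := hT.trans ht; positivity)
      (fun t ht => by have := one_le_log_exp (hT.trans ht); positivity)
      (fun t ht => by
        have h1 := one_le_log_exp (hT.trans ht)
        have h0 : 0 < t := by linarith
        have h := ((hasDerivAt_log_exp_mul h0).rpow_const (p := -ε)
          (Or.inl (by positivity))).div_const ε
        refine h.congr_deriv ?_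
        rw [show -ε - 1 = -(1 + ε) by ring, Real.rpow_neg (by linarith)]
        field_simp)
    simp only [logWeight, zero_add, one_ne_zero, if_false, if_true, mul_one]
    refine h.trans (ENNReal.ofReal_le_ofReal ?_)
    have h1 := one_le_log_exp hT
    have h2 : Real.log (Real.exp 1 * T) ^ (-ε) ≤ 1 := Real.rpow_le_one_of_one_le_of_nonpos h1
      (by linarith)
    have h3 : Real.log (Real.exp 1 * T) ^ (-ε) / ε ≤ 1 / ε := by gcongr
    gcongr
    linarith
  · have hL := one_le_log_exp hT
    -- For `p ≥ 1` the power of `t` alone converges, so the decreasing logarithmic factor may be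
    -- frozen at its value at `T`; what remains has the explicit primitive `-t^{-p} / p`.
    set l := (Real.log (Real.exp 1 * T) ^ (1 + ε))⁻¹ with hl
    have hl0 : 0 < l := by positivity
    have h := lintegral_unitDisc_le (fun t => (t ^ (p + 1))⁻¹ * l)
      (fun t => (t ^ p)⁻¹ / p * l) (by fun_prop) T
      (fun t ht => by have := hT.trans ht; positivity)
      (fun t ht => by have := hT.trans ht; positivity)
      (fun t ht => by
        have h0 : t ≠ 0 := by linarith
        have h := (((hasDerivAt_pow p t).inv (pow_ne_zero p h0)).div_const (p : ℝ)).mul_const l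
        refine h.congr_deriv ?_
        obtain ⟨p, rfl⟩ := Nat.exists_eq_succ_of_ne_zero hp.ne'
        have : ((p.succ : ℕ) : ℝ) ≠ 0 := by positivity
        simp only [Nat.succ_eq_add_one, Nat.add_sub_cancel] at this ⊢
        field_simp
        ring)
    refine le_trans (lintegral_mono fun w => ?_) (h.trans ?_)
    · gcongr
      rw [logWeight, if_neg p.succ_ne_zero, mul_inv]
      have ht : T ≤ T + |Real.log (‖w‖ ^ 2)| := le_add_of_nonneg_right (abs_nonneg _)
      have := one_le_log_exp (hT.trans ht)
      refine ENNReal.ofReal_le_ofReal ?_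
      rw [hl]
      gcongr
    · rw [logWeight, if_neg hp.ne', mul_inv, ← ENNReal.ofReal_mul (by positivity)]
      refine ENNReal.ofReal_le_ofReal ?_
      have hp1 : (1 : ℝ) ≤ p := by exact_mod_cast hp
      have h1 : (T ^ p)⁻¹ / p ≤ (T ^ p)⁻¹ := div_le_self (by positivity) hp1
      have h2 : 0 < 1 / ε := by positivity
      calc Real.pi * ((T ^ p)⁻¹ / p * l) ≤ Real.pi * ((T ^ p)⁻¹ * l) := by gcongr
        _ ≤ Real.pi * (1 + 1 / ε) * ((T ^ p)⁻¹ * l) := by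
          gcongr
          nlinarith

/-- Local integrability of `∏ |w_j|⁻² / (t^p (log (e t))^{1+ε})`, `t = 1 + ∑ |log |w_j|²|`, where
`p` is the number of coordinates `w_j` involved. -/
lemma lintegral_polydisc_lt_top {ι : Type*} [Fintype ι] {ε : ℝ} (hε : 0 < ε) (S : Finset ι)
    (a : ι → ℂ) (ha : ∀ j ∈ S, a j = 0) :
    ∫⁻ w in {w : ι → ℂ | ∀ j, ‖w j - a j‖ < 1}, (∏ j ∈ S, ‖w j‖ₑ ^ 2)⁻¹ *
      logWeight ε S.card (1 + ∑ j ∈ S, |Real.log (‖w j‖ ^ 2)|) < ⊤ := by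
  classical
  have hms : MeasurableSet {w : ι → ℂ | ∀ j, ‖w j - a j‖ < 1} := by
    rw [Set.ofPred_forall]
    exact MeasurableSet.iInter fun j => measurableSet_lt (by fun_prop) (by fun_prop)
  set V := volume (Metric.ball (0 : ℂ) 1) with hV
  have hVt : V < ⊤ := Metric.isBounded_ball.measure_lt_top
  have hpi := Real.pi_pos
  -- Variables in `S` have a pole at the centre of their disc and lower the exponent by one; the
  -- others only contribute the area `V`. The sum of the two constants serves both kinds.
  have key := lintegral_prod_mul_sum_le (logWeight ε) (measurable_logWeight ε)
    (fun j => if j ∈ S then 1 else 0)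
    (fun j => (Metric.ball (a j) 1).indicator fun w => if j ∈ S then (‖w‖ₑ ^ 2)⁻¹ else 1)
    (fun j => Measurable.indicator (by split_ifs <;> fun_prop) measurableSet_ball)
    (fun j w => if j ∈ S then |Real.log (‖w‖ ^ 2)| else 0)
    (fun j => by split_ifs <;> fun_prop)
    (fun j w => by split_ifs; exacts [abs_nonneg _, le_rfl])
    (ENNReal.ofReal (Real.pi * (1 + 1 / ε)) + V)
    (fun j p T hT => by
      by_cases hj : j ∈ S
      · simp only [hj, if_true, ha j hj]
        refine (lintegral_unitDisc_logWeight_le hε p hT).trans ?_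
        gcongr
        exact le_add_of_nonneg_right (zero_le (α := ℝ≥0∞))
      · simp only [hj, if_false, add_zero]
        rw [lintegral_mul_const _ (measurable_const.indicator measurableSet_ball),
          lintegral_indicator measurableSet_ball, setLIntegral_one,
          Complex.volume_ball, ← Complex.volume_ball 0]
        gcongr
        exact le_add_of_nonneg_left (zero_le (α := ℝ≥0∞)))
  rw [← lintegral_indicator hms]
  refine (lintegral_mono fun w => ?_).trans_lt (key.trans_lt ?_)
  · by_cases hw : w ∈ {w : ι → ℂ | ∀ j, ‖w j - a j‖ < 1}
    swap
    · rw [Set.indicator_of_notMem hw]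
      exact zero_le
    rw [Set.indicator_of_mem hw, Finset.prod_congr rfl fun j _ => Set.indicator_of_mem
      (show w j ∈ Metric.ball (a j) 1 by simpa [dist_eq_norm] using hw j) _]
    simp only [Finset.prod_ite_mem, Finset.sum_ite_mem, Finset.univ_inter, Finset.sum_const,
      smul_eq_mul, mul_one]
    gcongr
    rw [ENNReal.prod_inv_distrib]
    intro i _ j _ _
    exact Or.inr (by simp)
  · have : logWeight ε 0 1 = 1 := if_pos rfl
    rw [this, mul_one]
    exact ENNReal.pow_lt_top (ENNReal.add_lt_top.2 ⟨ENNReal.ofReal_lt_top, hVt⟩)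

end Integrals

/-! ### For smooth potentials `𝒥_{σ_mlc}` is the structure sheaf. -/

section SmoothPotentials

variable {n : ℕ} {X : Type u} [TopologicalSpace X] [ChartedSpace (Fin n → ℂ) X]
  {A : HolAtlas n X}

/-- If `φ_F` is a potential such that `m φ_F` is smooth for some `m ≥ 1`, then `φ_F` is smooth. -/
lemma Potential.isSmooth_of_smul {F : LineBundle A} {φ : Potential F} {m : ℕ} (hm : 1 ≤ m)
    (h : (φ.smul m).IsSmooth) : φ.IsSmooth := by
  obtain ⟨v, hv⟩ := h
  have hm0 : (m : ℝ) ≠ 0 := by positivity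
  refine ⟨⟨fun i x => v.toFun i x / m, fun i x hx => ?_, fun i j x hi hj => ?_⟩, fun i x hx => ?_⟩
  · exact ContDiffAt.div_const (v.smooth i x hx) (m : ℝ)
  · have e : Real.log (‖(F.pow m).g i j x‖ ^ 2) = m * Real.log (‖F.g i j x‖ ^ 2) := by
      simp only [LineBundle.pow, norm_pow]
      rw [← pow_mul, mul_comm m 2, pow_mul, Real.log_pow]
    have := v.compat i j x hi hj
    rw [e] at this
    rw [this]
    field_simp
  · have h1 : m • φ.toFun i x = (v.toFun i x : EReal) := hv i x hx
    have hbot : φ.toFun i x ≠ ⊥ := by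
      intro hb
      rw [hb] at h1
      obtain ⟨k, rfl⟩ := Nat.exists_eq_succ_of_ne_zero (Nat.one_le_iff_ne_zero.1 hm)
      rw [succ_nsmul, EReal.add_bot] at h1
      exact EReal.bot_ne_coe _ h1
    have htop := φ.ne_top i x
    lift φ.toFun i x to ℝ using ⟨htop, hbot⟩ with t
    rw [← EReal.coe_nsmul, EReal.coe_eq_coe_iff, nsmul_eq_mul] at h1
    rw [EReal.coe_eq_coe_iff, ← h1]
    field_simp

lemma Potential.IsSmooth.add {L M : LineBundle A} {φ : Potential L} {φ' : Potential M}
    (h : φ.IsSmooth) (h' : φ'.IsSmooth) : (φ.add φ').IsSmooth := by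
  obtain ⟨v, hv⟩ := h
  obtain ⟨v', hv'⟩ := h'
  refine ⟨⟨fun i x => v.toFun i x + v'.toFun i x, fun i x hx => ?_, fun i j x hi hj => ?_⟩,
    fun i x hx => ?_⟩
  · exact ContDiffAt.add (v.smooth i x hx) (v'.smooth i x hx)
  · have h1 := L.g_ne_zero i j x hi hj
    have h2 := M.g_ne_zero i j x hi hj
    have e : Real.log (‖(L.tensor M).g i j x‖ ^ 2) =
        Real.log (‖L.g i j x‖ ^ 2) + Real.log (‖M.g i j x‖ ^ 2) := by
      rw [← Real.log_mul (by positivity) (by positivity), ← mul_pow, ← norm_mul]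
      rfl
    rw [e, v.compat i j x hi hj, v'.compat i j x hi hj]
    ring
  · rw [EReal.coe_add, ← hv i x hx, ← hv' i x hx]
    rfl

/-- Bound of the pole weight in terms of the coordinates defining `D`. -/
lemma LogPair.poleWeight_le (P : LogPair A) {ε : ℝ} (hε : 0 < ε) (i : A.ι) (y : X)
    (hy : y ∈ (A.chart i).source) {B : ℝ} (S : Finset (Fin n)) (w : Fin n → ℂ)
    (hw : ∀ j ∈ S, ‖w j‖ < 1) (v : ℂ) (hv : v ≠ 0)
    (hB : |P.sm.toFun i y - Real.log (‖v‖ ^ 2)| ≤ B)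
    (hsec : P.D.sec.toFun i y = v * ∏ j ∈ S, w j) :
    P.poleWeight S.card ε i y ≤
      ENNReal.ofReal (Real.exp B * ((B + 2) ^ S.card * (1 + Real.log (B + 2)) ^ (1 + ε))) *
        ((∏ j ∈ S, ‖w j‖ₑ ^ 2)⁻¹ *
          logWeight ε S.card (1 + ∑ j ∈ S, |Real.log (‖w j‖ ^ 2)|)) := by
  have hB0 : 0 ≤ B := (abs_nonneg _).trans hB
  set t := 1 + ∑ j ∈ S, |Real.log (‖w j‖ ^ 2)| with ht
  have ht1 : 1 ≤ t := le_add_of_nonneg_right (Finset.sum_nonneg fun _ _ => abs_nonneg _)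
  have hL2 : 0 ≤ Real.log (B + 2) := Real.log_nonneg (by linarith)
  have hK : 0 < Real.exp B * ((B + 2) ^ S.card * (1 + Real.log (B + 2)) ^ (1 + ε)) := by
    positivity
  -- On `D` the pole weight is `⊤` by definition, and the right-hand side is `⊤` as well.
  by_cases h0 : P.D.sec.toFun i y = 0
  · have hprod : ∏ j ∈ S, ‖w j‖ₑ ^ 2 = 0 := by
      rw [hsec, mul_eq_zero, or_iff_right hv, Finset.prod_eq_zero_iff] at h0
      obtain ⟨j, hj, hj0⟩ := h0
      exact Finset.prod_eq_zero hj (by simp [hj0])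
    rw [hprod, ENNReal.inv_zero, ENNReal.top_mul (logWeight_ne_zero ε _ ht1),
      ENNReal.mul_top (ENNReal.ofReal_pos.2 hK).ne']
    exact le_top
  have hwj : ∀ j ∈ S, w j ≠ 0 := by
    rw [hsec, mul_eq_zero, or_iff_right hv, Finset.prod_eq_zero_iff] at h0
    exact fun j hj hj0 => h0 ⟨j, hj, hj0⟩
  obtain ⟨h1, h2⟩ := P.one_le_abs_psi i y hy h0
  rw [LogPair.poleWeight, if_neg h0]
  have hnorm : ‖P.D.sec.toFun i y‖ ^ 2 = ‖v‖ ^ 2 * ∏ j ∈ S, ‖w j‖ ^ 2 := by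
    rw [hsec, norm_mul, mul_pow, norm_prod, Finset.prod_pow]
  have hprod0 : 0 < ∏ j ∈ S, ‖w j‖ ^ 2 :=
    Finset.prod_pos fun j hj => by have := norm_pos_iff.2 (hwj j hj); positivity
  have hv2 : 0 < ‖v‖ ^ 2 := by positivity
  have hlog : Real.log (∏ j ∈ S, ‖w j‖ ^ 2) = -∑ j ∈ S, |Real.log (‖w j‖ ^ 2)| := by
    rw [Real.log_prod fun j hj => (pow_pos (norm_pos_iff.2 (hwj j hj)) 2).ne',
      ← Finset.sum_neg_distrib]
    refine Finset.sum_congr rfl fun j hj => ?_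
    rw [abs_of_nonpos, neg_neg]
    exact Real.log_nonpos (by positivity) (pow_le_one₀ (norm_nonneg _) (hw j hj).le)
  -- So `-ψ_D` differs from `t - 1` by at most `B`: this lets `|ψ_D|` be traded for `t`.
  have hpsi : -P.psi i y = (P.sm.toFun i y - Real.log (‖v‖ ^ 2)) + (t - 1) := by
    rw [LogPair.psi, hnorm, Real.log_mul hv2.ne' hprod0.ne', hlog, ht]
    ring
  obtain ⟨hB1, hB2⟩ := abs_le.1 hB
  have hexp : Real.exp (-P.psi i y) ≤ Real.exp B * (∏ j ∈ S, ‖w j‖ ^ 2)⁻¹ := by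
    rw [hpsi, Real.exp_add]
    have e : Real.exp (t - 1) = (∏ j ∈ S, ‖w j‖ ^ 2)⁻¹ := by
      rw [← Real.exp_log hprod0, hlog, ← Real.exp_neg, ht]
      ring_nf
    rw [e]
    gcongr
  set a := |P.psi i y| with ha
  -- From `t ≤ a + B + 1` and `1 ≤ a`.
  have hta : t ≤ (B + 2) * a := by nlinarith
  have hL1 := one_le_log_exp h1
  have hLt := one_le_log_exp ht1
  -- The additive error `log (B + 2)` becomes a factor because `log (e a) ≥ 1`.
  have hLa : Real.log (Real.exp 1 * t) ≤ (1 + Real.log (B + 2)) * Real.log (Real.exp 1 * a) := by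
    have h3 : Real.log (Real.exp 1 * t) ≤ Real.log ((B + 2) * (Real.exp 1 * a)) := by
      refine Real.log_le_log (by positivity) ?_
      calc Real.exp 1 * t ≤ Real.exp 1 * ((B + 2) * a) := by gcongr
        _ = _ := by ring
    rw [Real.log_mul (x := B + 2) (by positivity) (by positivity)] at h3
    nlinarith
  have hden : (a ^ S.card * Real.log (Real.exp 1 * a) ^ (1 + ε))⁻¹ ≤
      ((B + 2) ^ S.card * (1 + Real.log (B + 2)) ^ (1 + ε)) *
        (t ^ S.card * Real.log (Real.exp 1 * t) ^ (1 + ε))⁻¹ := by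
    rw [← div_eq_mul_inv, inv_eq_one_div, div_le_div_iff₀ (by positivity) (by positivity), one_mul]
    calc t ^ S.card * Real.log (Real.exp 1 * t) ^ (1 + ε) ≤
        ((B + 2) * a) ^ S.card *
          ((1 + Real.log (B + 2)) * Real.log (Real.exp 1 * a)) ^ (1 + ε) := by gcongr
      _ = _ := by rw [mul_pow, Real.mul_rpow (by positivity) (by positivity)]; ring
  have hinv : (∏ j ∈ S, ‖w j‖ₑ ^ 2)⁻¹ = ENNReal.ofReal (∏ j ∈ S, ‖w j‖ ^ 2)⁻¹ := by
    rw [ENNReal.ofReal_inv_of_pos hprod0, ENNReal.ofReal_prod_of_nonneg fun _ _ => by positivity]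
    refine congrArg _ (Finset.prod_congr rfl fun j _ => ?_)
    rw [ENNReal.ofReal_pow (norm_nonneg _), ofReal_norm]
  calc ENNReal.ofReal (Real.exp (-P.psi i y) / (a ^ S.card * Real.log (Real.exp 1 * a) ^ (1 + ε)))
      ≤ ENNReal.ofReal (Real.exp B * ((B + 2) ^ S.card * (1 + Real.log (B + 2)) ^ (1 + ε)) *
          ((∏ j ∈ S, ‖w j‖ ^ 2)⁻¹ *
            (t ^ S.card * Real.log (Real.exp 1 * t) ^ (1 + ε))⁻¹)) := by
        refine ENNReal.ofReal_le_ofReal ?_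
        rw [div_eq_mul_inv]
        calc _ ≤ (Real.exp B * (∏ j ∈ S, ‖w j‖ ^ 2)⁻¹) *
              (((B + 2) ^ S.card * (1 + Real.log (B + 2)) ^ (1 + ε)) *
                (t ^ S.card * Real.log (Real.exp 1 * t) ^ (1 + ε))⁻¹) := by gcongr
          _ = _ := by ring
    _ ≤ _ := by
        rw [ENNReal.ofReal_mul hK.le, ENNReal.ofReal_mul (inv_nonneg.2 hprod0.le), hinv]
        gcongr
        exact ofReal_le_logWeight hε _ ht1

/-- At most `σ_mlc` components of `D` pass through any given point. -/
lemma SNCDivisor.card_le_mlc (D : SNCDivisor A) (x : X) (T : Finset (Fin D.r))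
    (hT : ∀ k ∈ T, x ∈ D.comp k) : T.card ≤ D.mlc := by
  -- The bound by the number of components is needed: `sSup` of an unbounded set of naturals is `0`.
  refine le_csSup ⟨D.r, ?_⟩ ⟨x, T, rfl, hT⟩
  rintro _ ⟨_, T, rfl, -⟩
  simpa using T.card_le_univ

/-- Needed because the coordinates adapted to `D` lie in the maximal atlas but need not be charts of
`A`. -/
lemma analyticAt_comp_symm [IsManifold 𝓘(ℂ, Fin n → ℂ) ω X]
    {c z : OpenPartialHomeomorph X (Fin n → ℂ)}
    (hc : c ∈ IsManifold.maximalAtlas 𝓘(ℂ, Fin n → ℂ) ω X)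
    (hz : z ∈ IsManifold.maximalAtlas 𝓘(ℂ, Fin n → ℂ) ω X) {x : X} (hxc : x ∈ c.source)
    (hxz : x ∈ z.source) : AnalyticAt ℂ (c ∘ z.symm) (z x) := by
  have h := ((contDiffGroupoid ω 𝓘(ℂ, Fin n → ℂ)).compatible_of_mem_maximalAtlas hz hc)
  rw [contDiffGroupoid, mem_groupoid_of_pregroupoid] at h
  have h1 := h.1
  simp only [contDiffPregroupoid, modelWithCornersSelf_coe,
    modelWithCornersSelf_coe_symm, Function.id_comp, Function.comp_id, Set.preimage_id,
    Set.range_id, Set.inter_univ] at h1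
  have hmem : z x ∈ (z.symm.trans c).source := by simp [hxc, hxz]
  have := h1.contDiffAt ((z.symm.trans c).open_source.mem_nhds hmem)
  rw [← contDiffWithinAt_univ, contDiffWithinAt_omega_iff_analyticWithinAt,
    analyticWithinAt_univ] at this
  exact this

/-- For a smooth potential `φ`, `𝒥_{σ_mlc}(φ; ψ_D)` is the whole structure sheaf. -/
lemma LogPair.structureGerms_le_adjointIdeal [IsManifold 𝓘(ℂ, Fin n → ℂ) ω X] (P : LogPair A)
    {L : LineBundle A} {φ : Potential L} (hφ : φ.IsSmooth) (i : A.ι) (x : X) :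
    structureGerms A i x ≤ P.adjointIdeal P.D.mlc φ i x := by
  classical
  intro h hh
  by_cases hx : x ∈ (A.chart i).source
  swap
  · exact ⟨hh, fun hx' => absurd hx' hx⟩
  obtain ⟨φ', hφ'⟩ := hφ
  obtain ⟨z, k, v, hz, hv, hv0, hsec⟩ := P.D.sec_eq i x hx
  set c := A.chart i with hc
  have hcA := A.mem_maximalAtlas i
  set T := Finset.univ.filter fun k => x ∈ P.D.comp k with hT
  have hkT : Set.InjOn k T := hz.injOn.mono fun k hk => by simpa [hT] using hk
  set S := T.image k with hS
  have hcard : S.card ≤ P.D.mlc := by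
    rw [hS, Finset.card_image_of_injOn hkT]
    exact P.D.card_le_mlc x T fun k hk => by simpa [hT] using hk
  -- It suffices to treat the index equal to the number of components through `x`, which matches the
  -- number of poles of the weight.
  refine P.adjointIdeal_mono φ hcard i x ⟨hh, fun _ => ?_⟩
  have hzS : ∀ j ∈ S, z x j = 0 := by
    intro j hj
    obtain ⟨l, hl, rfl⟩ := Finset.mem_image.1 hj
    have hl' : x ∈ P.D.comp l := by simpa [hT] using hl
    exact ((hz.inter_eq l hl').subset ⟨hl', hz.mem_source⟩).2
  have cv : ContinuousAt v x := continuousAt_of_comp_symm c hx hv.continuousAt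
  have ch : ContinuousAt h x := continuousAt_of_comp_symm c hx (AnalyticAt.continuousAt hh)
  have cφ : ContinuousAt (φ'.toFun i) x :=
    continuousAt_of_comp_symm c hx (φ'.smooth i x hx).continuousAt
  have csm : ContinuousAt (P.sm.toFun i) x :=
    continuousAt_of_comp_symm c hx (P.sm.smooth i x hx).continuousAt
  have cB : ContinuousAt (fun y => |P.sm.toFun i y - Real.log (‖v y‖ ^ 2)|) x :=
    (csm.sub ((cv.norm.pow 2).log (by simpa using hv0))).abs
  have cz : ContinuousAt z x := z.continuousAt hz.mem_source
  -- The integral is taken in the chart `c`, the poles are visible in the chart `z`: the real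
  -- Jacobian of the coordinate change must be bounded near `x`.
  have cdet : ContinuousAt (fun w => |(fderiv ℝ (c ∘ z.symm) w).det|) (z x) :=
    (ContinuousLinearMap.continuous_det.continuousAt.comp
      (analyticAt_comp_symm hcA hz.mem_maximalAtlas hx
        hz.mem_source).restrictScalars.fderiv.continuousAt).abs
  have cJ : ContinuousAt (fun y => |(fderiv ℝ (c ∘ z.symm) (z y)).det|) x :=
    ContinuousAt.comp (f := z) (x := x) cdet cz
  set B := |P.sm.toFun i x - Real.log (‖v x‖ ^ 2)| + 1 with hBdef
  set J := |(fderiv ℝ (c ∘ z.symm) (z x)).det| + 1 with hJdef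
  have ev : ∀ᶠ y in 𝓝 x, y ∈ c.source ∧ y ∈ z.source ∧ (∀ j, ‖z y j - z x j‖ < 1) ∧
      ‖h y‖ < ‖h x‖ + 1 ∧ φ'.toFun i x - 1 < φ'.toFun i y ∧
      P.D.sec.toFun i y = v y * ∏ j ∈ S, z y j ∧ v y ≠ 0 ∧
      |P.sm.toFun i y - Real.log (‖v y‖ ^ 2)| < B ∧
      |(fderiv ℝ (c ∘ z.symm) (z y)).det| < J := by
    have ez : ∀ᶠ y in 𝓝 x, ∀ j, ‖z y j - z x j‖ < 1 := Filter.eventually_all.2 fun j => by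
      have h1 : ContinuousAt (fun y => ‖z y j - z x j‖) x :=
        (((continuous_apply j).continuousAt.comp cz).sub continuousAt_const).norm
      exact h1.eventually_lt continuousAt_const (by simp)
    filter_upwards [c.open_source.mem_nhds hx, z.open_source.mem_nhds hz.mem_source, ez,
      ch.norm.eventually_lt continuousAt_const (lt_add_one _),
      continuousAt_const.eventually_lt cφ (sub_one_lt _), hsec, cv.eventually_ne hv0,
      cB.eventually_lt continuousAt_const (lt_add_one _),
      cJ.eventually_lt continuousAt_const (lt_add_one _)] with y h1 h2 h3 h4 h5 h6 h7 h8 h9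
    refine ⟨h1, h2, h3, h4, h5, ?_, h7, h8, h9⟩
    -- Distinct components through `x` have distinct coordinates, so the product over components is
    -- a product over `S`.
    rw [h6, hS, Finset.prod_image hkT]
  obtain ⟨V, hV, hVo, hxV⟩ := eventually_nhds_iff.1 ev
  refine ⟨V, hVo, hxV, fun y hy => (hV y hy).1, ?_⟩
  rintro _ ⟨ε, hε, rfl⟩
  have hzV : MeasurableSet (z '' V) := measurableSet_image z hVo fun y hy => (hV y hy).2.1
  have himg : c '' V = (c ∘ z.symm) '' (z '' V) := by
    rw [Set.image_image]
    refine Set.image_congr fun y hy => ?_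
    simp [z.left_inv (hV y hy).2.1]
  have hinj : Set.InjOn (c ∘ z.symm) (z '' V) := by
    rintro _ ⟨y, hy, rfl⟩ _ ⟨y', hy', rfl⟩ e
    simp only [Function.comp_apply, z.left_inv (hV y hy).2.1, z.left_inv (hV y' hy').2.1] at e
    rw [c.injOn (hV y hy).1 (hV y' hy').1 e]
  have hder : ∀ w ∈ z '' V,
      HasFDerivWithinAt (c ∘ z.symm) (fderiv ℝ (c ∘ z.symm) w) (z '' V) w := by
    rintro _ ⟨y, hy, rfl⟩
    exact ((analyticAt_comp_symm hcA hz.mem_maximalAtlas (hV y hy).1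
      (hV y hy).2.1).restrictScalars.differentiableAt).hasFDerivAt.hasFDerivWithinAt
  -- Change of variables to the coordinates `z`. Afterwards the Jacobian, `h` and `e^{-φ}` are
  -- bounded on `V`, and only the model weight `Q` on a unit polydisc around `z x` remains.
  rw [himg, lintegral_image_eq_lintegral_abs_det_fderiv_mul volume hzV hder hinj]
  set K := Real.exp B * ((B + 2) ^ S.card * (1 + Real.log (B + 2)) ^ (1 + ε)) with hK
  set Q : (Fin n → ℂ) → ℝ≥0∞ := fun w => (∏ j ∈ S, ‖w j‖ₑ ^ 2)⁻¹ *
    logWeight ε S.card (1 + ∑ j ∈ S, |Real.log (‖w j‖ ^ 2)|) with hQ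
  set C : ℝ≥0∞ := ENNReal.ofReal J * (ENNReal.ofReal (‖h x‖ + 1) ^ 2 *
    (ENNReal.ofReal (Real.exp (-(φ'.toFun i x - 1))) * ENNReal.ofReal K)) with hC
  have hCt : C ≠ ⊤ := by
    simp [hC, ENNReal.mul_eq_top]
  have hbound : ∀ w ∈ z '' V, ENNReal.ofReal |(fderiv ℝ (c ∘ z.symm) w).det| *
      (‖h (c.symm ((c ∘ z.symm) w))‖ₑ ^ 2 *
        (EReal.exp (-φ.toFun i (c.symm ((c ∘ z.symm) w))) *
          P.poleWeight S.card ε i (c.symm ((c ∘ z.symm) w)))) ≤ C * Q w := by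
    rintro _ ⟨y, hy, rfl⟩
    obtain ⟨h1, h2, h3, h4, h5, h6, h7, h8, h9⟩ := hV y hy
    rw [Function.comp_apply, z.left_inv h2, c.left_inv h1, hφ' i y h1, ← EReal.coe_neg,
      EReal.exp_coe]
    have h10 := P.poleWeight_le hε i y h1 S (z y)
      (fun j hj => by simpa [hzS j hj] using h3 j) (v y) h7 h8.le h6
    have h11 : ‖h y‖ₑ ≤ ENNReal.ofReal (‖h x‖ + 1) := by
      rw [← ofReal_norm]
      exact ENNReal.ofReal_le_ofReal h4.le
    calc _ ≤ ENNReal.ofReal J * (ENNReal.ofReal (‖h x‖ + 1) ^ 2 *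
          (ENNReal.ofReal (Real.exp (-(φ'.toFun i x - 1))) * (ENNReal.ofReal K * Q (z y)))) := by
          gcongr
      _ = _ := by rw [hC]; ring
  refine (setLIntegral_mono' hzV hbound).trans_lt ?_
  rw [lintegral_const_mul' _ _ hCt]
  refine ENNReal.mul_lt_top hCt.lt_top ((lintegral_mono_set ?_).trans_lt
    (lintegral_polydisc_lt_top hε S (z x) hzS))
  rintro _ ⟨y, hy, rfl⟩
  exact (hV y hy).2.2.1

end SmoothPotentials

end AdjointInjectivity

end

/-! ### The theorem. -/

open AdjointInjectivity in
theorem mainTheorem2 {n : ℕ} {X : Type u} [TopologicalSpace X] [T2Space X] [CompactSpace X]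
    [ChartedSpace (Fin n → ℂ) X] [IsManifold 𝓘(ℂ, Fin n → ℂ) ω X] (hX : IsKahler n X)
    (A : HolAtlas n X) (P : LogPair A)
    (F : LineBundle A) (φF : Potential F) (hφF : φF.IsNeat P.D) (q : ℕ) :
    (∀ (M : LineBundle A) (φM : Potential M) (_ : φM.IsNeat P.D)
        (s : M.Section) (hs : s.IsBounded φM),
      (P.mu φF φM s hs 0 (Nat.zero_le _) q).ker = (P.iota φF 0 (Nat.zero_le _) q).ker →
      (∀ (σ : ℕ) (_ : 1 ≤ σ) (h : σ ≤ P.D.mlc),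
        (P.nu φF φM s hs σ h q).ker = (P.tau φF σ h q).ker) →
      Function.Injective (P.mu φF φM s hs P.D.mlc le_rfl q)) ∧
    (∀ (m : ℕ) (_ : 1 ≤ m) (hsm : (φF.smul m).IsSmooth) (s : (F.pow m).Section),
      (P.mu φF (φF.smul m) s (s.isBounded hsm) 0 (Nat.zero_le _) q).ker =
        (P.iota φF 0 (Nat.zero_le _) q).ker →
      (∀ (σ : ℕ) (_ : 1 ≤ σ) (h : σ ≤ P.D.mlc),
        (P.nu φF (φF.smul m) s (s.isBounded hsm) σ h q).ker = (P.tau φF σ h q).ker) →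
      Function.Injective (P.fujinoMap F m s q)) := by
  refine ⟨fun M φM _ s hs h0 hν => P.injective_mu_mlc φF φM s hs q h0 hν,
    fun m hm hsm s h0 hν => ?_⟩
  have hF := Potential.isSmooth_of_smul hm hsm
  exact P.injective_fujinoMap φF (φF.smul m) s (s.isBounded hsm) q
    (P.structureGerms_le_adjointIdeal hF)
    (P.injective_mu_mlc φF (φF.smul m) s (s.isBounded hsm) q h0 hν)
    -- The multiplier ideal needs no integral of its own: it contains `𝒥_{σ_mlc}(φ_F + m φ_F)`,
    -- which is already everything.
    fun i x => (P.structureGerms_le_adjointIdeal (hF.add hsm) i x).trans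
      (P.adjointIdeal_le _ _ i x)
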